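/- Let $D\ge 0$, let $\nu$ be a $\sigma$-finite Borel measure on $\mathbb R^D$ (Lebesgue measure for continuous data, a counting measure on a countable set for discrete data), and let $x_0$ have a probability density $p_0\ge 0$ with respect to $\nu$. Let $J\subseteq\mathbb R$ be open and let $s,\sigma$ be real functions of time that are, at every point of $J$, positive and differentiable with $\dot\sigma\ge 0$. Consider the SDE $$dX_t=\frac{\dot s(t)}{s(t)}X_t\,dt+s(t)\sqrt{2\dot\sigma(t)\sigma(t)}\,dW$$ with forward kernel $p(x_t\mid x_0)=\mathcal N\big(x_t;\,s(t)x_0,\,s(t)^2\sigma(t)^2 I\big)$. Let $p_t(x)=\int p(x_t=x\mid x_0)\,p_0(x_0)\,d\nu(x_0)$ be the Lebesgue density of $x_t$, let $p(x_0\mid x_t)=p(x_t\mid x_0)p_0(x_0)/p_t(x_t)$ be the posterior density, and put $$\mathbf H[x_0\mid x_t]=-\mathbb E\log p(x_0\mid x_t),\qquad \epsilon_t^2=\mathbb E\,\|x_0-\mathbb E[x_0\mid x_t]\|^2,\qquad \mathbf I[x_0;x_t]=\mathrm{KL}\big(\mathrm{law}(x_0,x_t)\,\|\,\mathrm{law}(x_0)\otimes\mathrm{law}(x_t)\big),$$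 where $\mathbb E[x_0\mid x_t]=\int y\,p(y\mid x_t)\,d\nu(y)$. Assume that the entropies $\mathbf H[x_0]$ and $\mathbf H[x_t]$, $t\in J$, are finite, i.e. $\mathbb E|\log p_0(x_0)|<\infty$ and $\mathbb E|\log p_t(x_t)|<\infty$. (0) For each $x_0$ the kernel $p(x_t\mid x_0)$ solves, for $t\in J$, the Fokker–Planck equation of the SDE, and it converges weakly to $\delta_{x_0}$ as $t\to t_0$ within $J$ whenever $s(t)\to1$ and $\sigma(t)\to0$ there. For every $t\in J$: (1) $\log p(x_0\mid x_t)$ is integrable, $\mathbf I[x_0;x_t]<\infty$, the integral defining $\mathbb E[x_0\mid x_t=x]$ converges absolutely for every $x$, and $\epsilon_t^2<\infty$. Moreover $\epsilon_t^2$ is the minimum of $\mathbb E\|x_0-\hat x(x_t)\|^2\in[0,\infty]$ over all measurable $\hat x:\mathbb R^D\to\mathbb R^D$, that is, the MMSE of recovering $x_0$ from $x_t$. (2) $\tau\mapsto\mathbf H[x_0\mid x_\tau]$ is differentiable at $t$, with $$\dot{\mathbf H}[x_0\mid x_t]=\frac{\dot\sigma(t)}{\sigma(t)^3}\,\epsilon_t^2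 .$$ (3) (I-MMSE identity) $\tau\mapsto\mathbf I[x_0;x_\tau]$ is differentiable at $t$, with $$\dot{\mathbf I}[x_0;x_t]=\frac12\,\frac{d}{dt}\Big(\frac1{\sigma(t)^2}\Big)\,\epsilon_t^2 .$$ (4) For real weights $\lambda(t)>0$, $c_{out}(t)$, $c_{skip}(t)$ and a measurable network $F:\mathbb R^D\to\mathbb R^D$ let $$\mathcal L_F(t)=\mathbb E_{x_0\sim p_0,\ \epsilon\sim\mathcal N(0,I)}\Big[\lambda(t)\,\big\|c_{out}(t)F(x_t)-s(t)x_0+c_{skip}(t)x_t\big\|^2\Big]\in[0,\infty],\qquad x_t=s(t)x_0+s(t)\sigma(t)\epsilon,$$ be the EDM training loss at time $t$. If the prediction of $F$ is the optimal denoiser, i.e. $\frac{c_{out}(t)F(x)+c_{skip}(t)x}{s(t)}=\mathbb E[x_0\mid x_t=x]$ for $p_t$-almost every $x$, then $\mathcal L_F(t)=\lambda(t)s(t)^2\epsilon_t^2$, the loss $\mathcal L_F(t)$ is minimal among all measurable networks, and $$\dot{\mathbf H}[x_0\mid x_t]=\frac{\dot\sigma(t)}{\lambda(t)\,s(t)^2\,\sigma(t)^3}\,\mathcal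 L_F(t).$$ -/

import Mathlib

open MeasureTheory ProbabilityTheory Filter Topology
open scoped ENNReal

noncomputable section

namespace EDM

/-- The state space `ℝ^D` with its Euclidean norm. -/
abbrev E (D : ℕ) : Type := EuclideanSpace ℝ (Fin D)

/-! ### The forward SDE and its kernel -/

/-- The drift `f_t(x) = (s'(t) / s(t)) x` of the EDM forward SDE `dX = f_t(X) dt + g(t) dW`. -/
def drift {D : ℕ} (s : ℝ → ℝ) (t : ℝ) (x : E D) : E D := (deriv s t / s t) • x

/-- The diffusion coefficient `g(t) = s(t) √(2 σ'(t) σ(t))` of the EDM forward SDE. -/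
def diffusion (s σ : ℝ → ℝ) (t : ℝ) : ℝ := s t * Real.sqrt (2 * deriv σ t * σ t)

/-- The divergence `∑ i, ∂_i V_i` of a vector field on `ℝ^D`. -/
def divergence {D : ℕ} (V : E D → E D) (x : E D) : ℝ :=
  ∑ i : Fin D, (fderiv ℝ V x (EuclideanSpace.single i 1)) i

/-- The function `p` (time, then space) solves at `(t, x)` the Fokker–Planck equation
`∂_t p = - div (p f) + (g² / 2) Δ p` of the SDE `dX = f_t(X) dt + g(t) dW`. -/
def SolvesFokkerPlanckAt {D : ℕ} (f : ℝ → E D → E D) (g : ℝ → ℝ) (p : ℝ → E D → ℝ)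
    (t : ℝ) (x : E D) : Prop :=
  ContDiffAt ℝ 2 (p t) x ∧
  HasDerivAt (fun τ => p τ x)
    (-divergence (fun y => p t y • f t y) x + g t ^ 2 / 2 * Laplacian.laplacian (p t) x) t

/-- The forward kernel `p(x_t = x | x_0)`: the density at `x` of `N(s(t) x_0, s(t)² σ(t)² I)`. -/
def forwardDensity {D : ℕ} (s σ : ℝ → ℝ) (t : ℝ) (x₀ x : E D) : ℝ :=
  (2 * Real.pi * (s t ^ 2 * σ t ^ 2)) ^ (-(D : ℝ) / 2) *
    Real.exp (-‖x - s t • x₀‖ ^ 2 / (2 * (s t ^ 2 * σ t ^ 2)))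

/-! ### Laws and densities

The data density `p₀` is taken with respect to a reference measure `ν`
(Lebesgue measure for continuous data, a counting measure for discrete data). -/

/-- The law `p₀ dν` of `x_0`. -/
def dataLaw {D : ℕ} (ν : Measure (E D)) (p₀ : E D → ℝ) : Measure (E D) :=
  ν.withDensity fun x₀ => ENNReal.ofReal (p₀ x₀)

/-- The joint law of `(x_0, x_t)`, with density `p(x_t | x_0) p₀(x_0)`. -/
def jointLaw {D : ℕ} (ν : Measure (E D)) (p₀ : E D → ℝ) (s σ : ℝ → ℝ) (t : ℝ) :
    Measure (E D × E D) :=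
  (ν.prod volume).withDensity fun z =>
    ENNReal.ofReal (forwardDensity s σ t z.1 z.2 * p₀ z.1)

/-- The Lebesgue density `p_t` of `x_t`. -/
def marginalDensity {D : ℕ} (ν : Measure (E D)) (p₀ : E D → ℝ) (s σ : ℝ → ℝ) (t : ℝ)
    (x : E D) : ℝ :=
  ∫ x₀, forwardDensity s σ t x₀ x * p₀ x₀ ∂ν

/-- The law of `x_t`. -/
def marginalLaw {D : ℕ} (ν : Measure (E D)) (p₀ : E D → ℝ) (s σ : ℝ → ℝ) (t : ℝ) :
    Measure (E D) :=
  volume.withDensity fun x => ENNReal.ofReal (marginalDensity ν p₀ s σ t x)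

/-- The posterior density `p(x_0 | x_t = x)` with respect to `ν`, by Bayes' rule. -/
def posteriorDensity {D : ℕ} (ν : Measure (E D)) (p₀ : E D → ℝ) (s σ : ℝ → ℝ) (t : ℝ)
    (x₀ x : E D) : ℝ :=
  forwardDensity s σ t x₀ x * p₀ x₀ / marginalDensity ν p₀ s σ t x

/-- The posterior mean `E[x_0 | x_t = x]`. -/
def posteriorMean {D : ℕ} (ν : Measure (E D)) (p₀ : E D → ℝ) (s σ : ℝ → ℝ) (t : ℝ)
    (x : E D) : E D :=
  ∫ y₀, posteriorDensity ν p₀ s σ t y₀ x • y₀ ∂ν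

/-! ### Entropy, information, squared error, loss -/

/-- The conditional entropy `H[x_0 | x_t] = - E[log p(x_0 | x_t)]`. -/
def condEntropy {D : ℕ} (ν : Measure (E D)) (p₀ : E D → ℝ) (s σ : ℝ → ℝ) (t : ℝ) : ℝ :=
  -∫ z, Real.log (posteriorDensity ν p₀ s σ t z.1 z.2) ∂(jointLaw ν p₀ s σ t)

/-- The mutual information `I[x_0; x_t]`: the Kullback–Leibler divergence of the joint law
from the product of the laws of `x_0` and `x_t`. -/
def mutualInfo {D : ℕ} (ν : Measure (E D)) (p₀ : E D → ℝ) (s σ : ℝ → ℝ) (t : ℝ) : ℝ≥0∞ :=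
  InformationTheory.klDiv (jointLaw ν p₀ s σ t)
    ((dataLaw ν p₀).prod (marginalLaw ν p₀ s σ t))

/-- The squared error `ε_t² = E ‖x_0 - E[x_0 | x_t]‖²`. -/
def sqError {D : ℕ} (ν : Measure (E D)) (p₀ : E D → ℝ) (s σ : ℝ → ℝ) (t : ℝ) : ℝ :=
  ∫ z, ‖z.1 - posteriorMean ν p₀ s σ t z.2‖ ^ 2 ∂(jointLaw ν p₀ s σ t)

/-- The mean squared error `E ‖x_0 - x̂(x_t)‖² ∈ [0, ∞]` of an estimator `x̂` of `x_0`. -/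
def estimatorError {D : ℕ} (ν : Measure (E D)) (p₀ : E D → ℝ) (s σ : ℝ → ℝ) (t : ℝ)
    (xhat : E D → E D) : ℝ≥0∞ :=
  ∫⁻ z, ENNReal.ofReal (‖z.1 - xhat z.2‖ ^ 2) ∂(jointLaw ν p₀ s σ t)

/-- The prediction `x̂_0(x) = (c_out(t) F(x) + c_skip(t) x) / s(t)` of a network `F`. -/
def prediction {D : ℕ} (s cout cskip : ℝ → ℝ) (F : E D → E D) (t : ℝ) (x : E D) : E D :=
  (s t)⁻¹ • (cout t • F x + cskip t • x)

/-- The EDM training loss at time `t` of a network `F`, with values in `[0, ∞]`: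
`E_{x_0 ∼ p₀, ε ∼ N(0, I)} [λ(t) ‖c_out F(x_t) - s x_0 + c_skip x_t‖²]`, `x_t = s x_0 + s σ ε`. -/
def trainingLoss {D : ℕ} (ν : Measure (E D)) (p₀ : E D → ℝ) (s σ lam cout cskip : ℝ → ℝ)
    (F : E D → E D) (t : ℝ) : ℝ≥0∞ :=
  ∫⁻ z, ENNReal.ofReal (lam t *
      ‖cout t • F (s t • z.1 + (s t * σ t) • z.2) - s t • z.1
        + cskip t • (s t • z.1 + (s t * σ t) • z.2)‖ ^ 2)
    ∂((dataLaw ν p₀).prod (stdGaussian (E D)))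

end EDM

end

/-!
Up to the scaling by `s`, the variable `x_t` is the output of the Gaussian channel `y = a x_0 + ε`
with gain `a = 1 / σ(t)`. For a true signal `x` and a true noise `z` let
`L(a; x, z) = ∫ exp (-‖a (x - x') + z‖² / 2) dP(x')` be the (unnormalized) evidence of the observation
`a x + z`, where `P` is the law of `x_0` (`channelEvidence`). Then
`log (p(x_t | x_0) / p_t(x_t)) = -log L(a; x_0, ε) - ‖ε‖² / 2`, so that `I[x_0; x_t]` is
`E[-log L(a; x_0, ε)]` minus a constant (`mutualInfo_eq`), and `H[x_0 | x_t] = H[x_0] - I[x_0; x_t]`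
(`condEntropy_eq`). Everything reduces to the derivative of `E[-log L(a; x_0, ε)]` in `a`, with the
law of `(x_0, ε)` independent of `a`.

Pointwise, this derivative is the posterior expectation of `⟪a (x - x') + z, x - x'⟫` over `x'`. The
point is to dominate it without any moment assumption on `x_0`. Writing `w = a (x - x') + z`, it is at
most a multiple of the posterior mean of `‖w‖²` plus `‖z‖²`; the Gibbs inequality bounds the posterior
mean of `‖w‖²` by `-4 log L(a; x, z)` (`integral_channelWeight_mul_norm_sq_le`); and a Harnack-type
inequality, `-log L(a) ≤ ‖z‖² - 8 log L(a₀)` for `0 < a ≤ 2 a₀`, makes this uniform for `a` near `a₀`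
(`neg_log_channelEvidence_le`). Finiteness of `H[x_t]` says exactly that `log L(a₀)` is integrable, so
the expectation can be differentiated at `a₀` (`hasDerivAt_integral_neg_log_channelEvidence`).

With `m` the posterior mean and `V` the posterior variance, the derivative equals
`⟪a (x - m) + z, x - m⟫ + a V`. Since `a (x - m) + z` is a function of the observation, the first term
averages to zero by the orthogonality of `x_0 - m` to such functions, and `V` averages to `ε_t²`. Hence
the derivative in `a` is `a ε_t²` (`integral_channelScore_div_channelEvidence`), and the chain rule with
`a = 1 / σ` gives both rates.

The error `ε_t²` is finite because the estimator `x_t / s` has error `σ² E ‖ε‖²`; its minimality is the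
bias–variance decomposition under the posterior law. The training loss is `λ s²` times the mean
squared error of the prediction (`trainingLoss_eq`). The Fokker–Planck equation is an explicit
computation with Gaussians, and the weak convergence is dominated convergence under the law of the
noise.
-/

namespace EDM

/-! ### The density of an isotropic Gaussian -/

/-- The isotropic Gaussian law with mean `m` and standard deviation `c` has the usual Lebesgue
density. Both measures are finite, and their characteristic functions agree. -/
theorem withDensity_gaussian_eq_map_stdGaussian {D : ℕ} (m : E D) {c : ℝ} (hc : 0 < c) :
    (volume : Measure (E D)).withDensity (fun x => ENNReal.ofReal
      ((2 * Real.pi * c ^ 2) ^ (-(D : ℝ) / 2) * Real.exp (-‖x - m‖ ^ 2 / (2 * c ^ 2))))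
      = (stdGaussian (E D)).map (fun z => m + c • z) := by
  have hpos : 0 < 2 * Real.pi * c ^ 2 := by positivity
  set K : ℝ := (2 * Real.pi * c ^ 2) ^ (-(D : ℝ) / 2) with hK
  have hK0 : 0 < K := Real.rpow_pos_of_pos hpos _
  have hint : Integrable (fun x : E D => K * Real.exp (-‖x - m‖ ^ 2 / (2 * c ^ 2))) := by
    refine Integrable.const_mul ?_ K
    have h := (GaussianFourier.integrable_cexp_neg_mul_sq_norm_add (V := E D)
      (b := ((1 / (2 * c ^ 2) : ℝ) : ℂ)) (by rw [Complex.ofReal_re]; positivity) 0 0).norm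
    have h2 := h.comp_sub_right m
    refine h2.congr (Eventually.of_forall fun x => ?_)
    simp only [Complex.norm_exp]
    congr 1
    rw [← Complex.ofReal_pow]
    simp [-Complex.ofReal_pow]
    ring
  have : IsFiniteMeasure ((volume : Measure (E D)).withDensity (fun x => ENNReal.ofReal
      (K * Real.exp (-‖x - m‖ ^ 2 / (2 * c ^ 2))))) := by
    refine isFiniteMeasure_withDensity_ofReal hint.2
  have haff : Measurable (fun z : E D => m + c • z) := by fun_prop
  have : IsProbabilityMeasure ((stdGaussian (E D)).map (fun z => m + c • z)) :=
    Measure.isProbabilityMeasure_map haff.aemeasurable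
  refine Measure.ext_of_charFun ?_
  ext t
  have hL : charFun ((volume : Measure (E D)).withDensity (fun x => ENNReal.ofReal
      (K * Real.exp (-‖x - m‖ ^ 2 / (2 * c ^ 2))))) t
      = ∫ x : E D, (K : ℂ) * (Complex.exp (-((1 / (2 * c ^ 2) : ℝ) : ℂ) * ‖x - m‖ ^ 2
          + Complex.I * (inner ℝ t (x - m) : ℝ)) * Complex.exp ((inner ℝ m t : ℝ) * Complex.I)) := by
    rw [charFun_apply, integral_withDensity_eq_integral_toReal_smul (by fun_prop) (by simp)]
    refine integral_congr_ae (Eventually.of_forall fun x => ?_)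
    simp only
    rw [ENNReal.toReal_ofReal (by positivity), Complex.real_smul, Complex.ofReal_mul, mul_assoc,
      Complex.ofReal_exp, ← Complex.exp_add, ← Complex.exp_add, inner_sub_right,
      real_inner_comm t m, real_inner_comm t x]
    congr 2
    push_cast
    field_simp
    ring
  rw [hL, integral_sub_right_eq_self (fun x : E D => (K : ℂ) * (Complex.exp
    (-((1 / (2 * c ^ 2) : ℝ) : ℂ) * ‖x‖ ^ 2
          + Complex.I * (inner ℝ t x : ℝ)) * Complex.exp ((inner ℝ m t : ℝ) * Complex.I))) m,
    integral_const_mul, integral_mul_const,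
    GaussianFourier.integral_cexp_neg_mul_sq_norm_add (by rw [Complex.ofReal_re]; positivity)]
  have hR : charFun ((stdGaussian (E D)).map (fun z => m + c • z)) t
      = charFun (stdGaussian (E D)) (c • t) * Complex.exp ((inner ℝ m t : ℝ) * Complex.I) := by
    rw [charFun_apply, charFun_apply, integral_map haff.aemeasurable (by fun_prop),
      ← integral_mul_const]
    refine integral_congr_ae (Eventually.of_forall fun x => ?_)
    simp only
    rw [← Complex.exp_add, inner_add_left, real_inner_smul_left, real_inner_smul_right]
    push_cast
    ring_nf
  rw [hR, charFun_stdGaussian, ← mul_assoc, ← mul_assoc]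
  congr 1
  have h1 : (K : ℂ) * ((Real.pi : ℂ) / ((1 / (2 * c ^ 2) : ℝ) : ℂ)) ^
      ((Module.finrank ℝ (E D) : ℂ) / 2) = 1 := by
    have e1 : ((Real.pi : ℂ) / ((1 / (2 * c ^ 2) : ℝ) : ℂ)) = ((2 * Real.pi * c ^ 2 : ℝ) : ℂ) := by
      push_cast
      field_simp
    have e2 : ((Module.finrank ℝ (E D) : ℂ) / 2) = (((D : ℝ) / 2 : ℝ) : ℂ) := by
      simp
    rw [e1, e2, ← Complex.ofReal_cpow hpos.le, ← Complex.ofReal_mul, hK,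
      ← Real.rpow_add hpos]
    simp [neg_div]
  rw [h1, one_mul]
  congr 1
  have : (c : ℂ) ≠ 0 := by exact_mod_cast hc.ne'
  rw [norm_smul]
  push_cast
  rw [Complex.I_sq, mul_pow, ← Complex.ofReal_pow ‖c‖, Real.norm_eq_abs, sq_abs]
  push_cast
  field_simp
  ring


/-! ### The Fokker–Planck equation and the initial condition -/

theorem hasFDerivAt_gaussian {D : ℕ} (K V : ℝ) (m x : E D) :
    HasFDerivAt (fun y : E D => K * Real.exp (-‖y - m‖ ^ 2 / (2 * V)))
      ((-(K * Real.exp (-‖x - m‖ ^ 2 / (2 * V))) / V) • innerSL ℝ (x - m)) x := by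
  have h1 : HasFDerivAt (fun y : E D => ‖y - m‖ ^ 2) (2 • innerSL ℝ (x - m)) x := by
    simpa using ((hasFDerivAt_id x).sub_const m).norm_sq
  have h2 := ((h1.neg.mul_const (2 * V)⁻¹).exp).const_mul K
  have e : (fun y : E D => K * Real.exp (-‖y - m‖ ^ 2 / (2 * V)))
      = fun y => K * Real.exp (-‖y - m‖ ^ 2 * (2 * V)⁻¹) := by
    funext y; rw [div_eq_mul_inv]
  rw [e]
  refine h2.congr_fderiv ?_
  ext v
  simp [div_eq_mul_inv]
  ring

theorem divergence_gaussian_smul {D : ℕ} (K V b : ℝ) (m x : E D) :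
    divergence (fun y : E D => (K * Real.exp (-‖y - m‖ ^ 2 / (2 * V))) • (b • y)) x
      = K * Real.exp (-‖x - m‖ ^ 2 / (2 * V)) * b * (D - inner ℝ (x - m) x / V) := by
  have h : HasFDerivAt (fun y : E D => (K * Real.exp (-‖y - m‖ ^ 2 / (2 * V))) • (b • y)) _ x :=
    (hasFDerivAt_gaussian K V m x).smul ((hasFDerivAt_id x).const_smul b)
  have hsum : inner ℝ (x - m) x = ∑ i, (x - m) i * x i := by
    rw [PiLp.inner_apply]
    refine Finset.sum_congr rfl fun i _ => ?_
    simp [mul_comm]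
  unfold divergence
  have e : ∀ i : Fin D, (fderiv ℝ (fun y : E D => (K * Real.exp (-‖y - m‖ ^ 2 / (2 * V))) • (b • y))
      x (EuclideanSpace.single i 1)) i
      = K * Real.exp (-‖x - m‖ ^ 2 / (2 * V)) * b
        - K * Real.exp (-‖x - m‖ ^ 2 / (2 * V)) * b / V * ((x - m) i * x i) := by
    intro i
    rw [h.fderiv]
    simp [EuclideanSpace.inner_single_right]
    ring
  rw [Finset.sum_congr rfl fun i _ => e i, Finset.sum_sub_distrib,
    Finset.sum_const, ← Finset.mul_sum, ← hsum]
  simp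
  ring

/-- Here the derivative of the Gaussian is differentiated once more as a map with values in
`E D →L[ℝ] ℝ`, and the second derivative is traced over the standard basis. -/
theorem laplacian_gaussian {D : ℕ} (K V : ℝ) (m x : E D) :
    Laplacian.laplacian (fun y : E D => K * Real.exp (-‖y - m‖ ^ 2 / (2 * V))) x
      = K * Real.exp (-‖x - m‖ ^ 2 / (2 * V)) * (‖x - m‖ ^ 2 / V ^ 2 - D / V) := by
  rw [InnerProductSpace.laplacian_eq_iteratedFDeriv_orthonormalBasis _
    (EuclideanSpace.basisFun (Fin D) ℝ)]
  have h1 : fderiv ℝ (fun y : E D => K * Real.exp (-‖y - m‖ ^ 2 / (2 * V)))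
      = fun y => (-(K * Real.exp (-‖y - m‖ ^ 2 / (2 * V))) / V) • innerSL ℝ (y - m) := by
    funext y
    exact (hasFDerivAt_gaussian K V m y).fderiv
  -- over `ℝ` the conjugate-linear map `innerSL ℝ` is linear
  obtain ⟨T, hT⟩ : ∃ T : E D →L[ℝ] E D →L[ℝ] ℝ, ∀ u, T u = innerSL ℝ u :=
    ⟨innerSL ℝ, fun _ => rfl⟩
  have h2 := ((hasFDerivAt_gaussian K V m x).neg.mul_const V⁻¹).smul
    (T.hasFDerivAt.comp x ((hasFDerivAt_id x).sub_const m))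
  have hsum : ‖x - m‖ ^ 2 = ∑ i, (x - m) i ^ 2 := by
    rw [EuclideanSpace.norm_sq_eq]
    simp
  have e : ∀ i : Fin D, iteratedFDeriv ℝ 2 (fun y : E D => K * Real.exp (-‖y - m‖ ^ 2 / (2 * V))) x
      ![EuclideanSpace.basisFun (Fin D) ℝ i, EuclideanSpace.basisFun (Fin D) ℝ i]
      = K * Real.exp (-‖x - m‖ ^ 2 / (2 * V)) / V ^ 2 * (x - m) i ^ 2
        - K * Real.exp (-‖x - m‖ ^ 2 / (2 * V)) / V := by
    intro i
    rw [iteratedFDeriv_two_apply, h1]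
    simp only [← hT]
    have h3 : HasFDerivAt (fun y : E D =>
      (-(K * Real.exp (-‖y - m‖ ^ 2 / (2 * V))) / V) • T (y - m)) _ x := h2
    rw [h3.fderiv]
    simp [EuclideanSpace.inner_single_right, hT]
    ring
  simp only
  rw [Finset.sum_congr rfl fun i _ => e i, Finset.sum_sub_distrib,
    Finset.sum_const, ← Finset.mul_sum, ← hsum]
  simp
  ring

theorem hasDerivAt_forwardDensity {D : ℕ} {s σ : ℝ → ℝ} {t : ℝ} (hs : 0 < s t) (hσ : 0 < σ t)
    (hs' : DifferentiableAt ℝ s t) (hσ' : DifferentiableAt ℝ σ t) (x₀ x : E D) :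
    HasDerivAt (fun τ => forwardDensity s σ τ x₀ x)
      (forwardDensity s σ t x₀ x *
        (-D * (deriv s t / s t + deriv σ t / σ t)
          + deriv s t * inner ℝ (x - s t • x₀) x₀ / (s t ^ 2 * σ t ^ 2)
          + ‖x - s t • x₀‖ ^ 2 * (deriv s t / s t + deriv σ t / σ t)
            / (s t ^ 2 * σ t ^ 2))) t := by
  have ds := hs'.hasDerivAt
  have dV := (ds.pow 2).mul (hσ'.hasDerivAt.pow 2)
  have hV : 0 < s t ^ 2 * σ t ^ 2 := by positivity
  have dK := ((dV.const_mul (2 * Real.pi)).rpow_const (p := -(D : ℝ) / 2)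
    (Or.inl (by simp only [Pi.mul_apply, Pi.pow_apply]; positivity)))
  have dr : HasDerivAt (fun τ => x - s τ • x₀) (-(deriv s t • x₀)) t := by
    simpa using (ds.smul_const x₀).const_sub x
  have dn := dr.norm_sq
  have de := ((dn.neg.div (dV.const_mul 2)
    (by simp only [Pi.mul_apply, Pi.pow_apply]; positivity)).exp)
  have h := dK.mul de
  refine h.congr_deriv ?_
  simp only [forwardDensity, Pi.mul_apply, Pi.pow_apply, Pi.neg_apply, Pi.div_apply]
  rw [Real.rpow_sub_one (by positivity), inner_neg_right, real_inner_smul_right]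
  field_simp
  ring

theorem solvesFokkerPlanckAt_forwardDensity {D : ℕ} {s σ : ℝ → ℝ} {t : ℝ} (hs : 0 < s t)
    (hσ : 0 < σ t) (hs' : DifferentiableAt ℝ s t) (hσ' : DifferentiableAt ℝ σ t)
    (hmono : 0 ≤ deriv σ t) (x₀ x : E D) :
    SolvesFokkerPlanckAt (drift s) (diffusion s σ)
      (fun τ y => forwardDensity s σ τ x₀ y) t x := by
  refine ⟨?_, ?_⟩
  · have : ContDiff ℝ 2 (fun y : E D => forwardDensity s σ t x₀ y) := by
      unfold forwardDensity
      simp only [div_eq_mul_inv]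
      exact contDiff_const.mul ((((contDiff_id.sub contDiff_const).norm_sq ℝ).neg.mul
        contDiff_const).exp)
    exact this.contDiffAt
  · refine (hasDerivAt_forwardDensity hs hσ hs' hσ' x₀ x).congr_deriv ?_
    have h1 : divergence (fun y : E D => forwardDensity s σ t x₀ y • drift s t y) x = _ :=
      divergence_gaussian_smul _ (s t ^ 2 * σ t ^ 2) (deriv s t / s t) (s t • x₀) x
    have h2 : Laplacian.laplacian (fun y : E D => forwardDensity s σ t x₀ y) x = _ :=
      laplacian_gaussian _ (s t ^ 2 * σ t ^ 2) (s t • x₀) x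
    have h3 : diffusion s σ t ^ 2 = s t ^ 2 * (2 * deriv σ t * σ t) := by
      rw [diffusion, mul_pow, Real.sq_sqrt (by positivity)]
    have h4 : inner ℝ (x - s t • x₀) x
        = ‖x - s t • x₀‖ ^ 2 + s t * inner ℝ (x - s t • x₀) x₀ := by
      rw [← real_inner_self_eq_norm_sq, ← real_inner_smul_right, ← inner_add_right,
        sub_add_cancel]
    -- both sides are now rational expressions times the density, in the unknowns `s`, `s'`, `σ`,
    -- `σ'`, `D`, `‖x - s x₀‖²` and `⟪x - s x₀, x₀⟫`
    rw [h1, h2, h3, h4]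
    simp only [forwardDensity]
    field_simp
    ring

theorem withDensity_forwardDensity {D : ℕ} {s σ : ℝ → ℝ} {t : ℝ} (hs : 0 < s t) (hσ : 0 < σ t)
    (x₀ : E D) :
    (volume : Measure (E D)).withDensity (fun x => ENNReal.ofReal (forwardDensity s σ t x₀ x))
      = (stdGaussian (E D)).map (fun z => s t • x₀ + (s t * σ t) • z) := by
  rw [← withDensity_gaussian_eq_map_stdGaussian (s t • x₀) (mul_pos hs hσ)]
  simp only [forwardDensity, mul_pow]

theorem forwardDensity_pos {D : ℕ} {s σ : ℝ → ℝ} {t : ℝ} (hs : 0 < s t) (hσ : 0 < σ t)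
    (x₀ x : E D) : 0 < forwardDensity s σ t x₀ x := by
  unfold forwardDensity
  positivity

theorem measurable_forwardDensity {D : ℕ} (s σ : ℝ → ℝ) (t : ℝ) :
    Measurable fun z : E D × E D => forwardDensity s σ t z.1 z.2 := by
  unfold forwardDensity
  fun_prop

theorem measurable_forwardDensity_right {D : ℕ} (s σ : ℝ → ℝ) (t : ℝ) (x₀ : E D) :
    Measurable fun x : E D => forwardDensity s σ t x₀ x := by
  unfold forwardDensity
  fun_prop

theorem tendsto_integral_forwardDensity {D : ℕ} {J : Set ℝ} {s σ : ℝ → ℝ}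
    (hs : ∀ t ∈ J, 0 < s t) (hσ : ∀ t ∈ J, 0 < σ t) (x₀ : E D) {t₀ : ℝ}
    (hs₀ : Tendsto s (𝓝[J] t₀) (𝓝 1)) (hσ₀ : Tendsto σ (𝓝[J] t₀) (𝓝 0))
    (φ : BoundedContinuousFunction (E D) ℝ) :
    Tendsto (fun τ => ∫ x, φ x * forwardDensity s σ τ x₀ x) (𝓝[J] t₀) (𝓝 (φ x₀)) := by
  have h1 : ∀ τ ∈ J, ∫ x, φ x * forwardDensity s σ τ x₀ x
      = ∫ z, φ (s τ • x₀ + (s τ * σ τ) • z) ∂(stdGaussian (E D)) := by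
    intro τ hτ
    rw [← integral_map (f := fun y => φ y) (φ := fun z => s τ • x₀ + (s τ * σ τ) • z) (by fun_prop)
      φ.continuous.aestronglyMeasurable, ← withDensity_forwardDensity (hs τ hτ) (hσ τ hτ),
      integral_withDensity_eq_integral_toReal_smul
        (measurable_forwardDensity_right s σ τ x₀).ennreal_ofReal (by simp)]
    refine integral_congr_ae (Eventually.of_forall fun x => ?_)
    simp only [smul_eq_mul]
    rw [ENNReal.toReal_ofReal (forwardDensity_pos (hs τ hτ) (hσ τ hτ) x₀ x).le, mul_comm]
  have h2 : Tendsto (fun τ => ∫ z, φ (s τ • x₀ + (s τ * σ τ) • z) ∂(stdGaussian (E D)))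
      (𝓝[J] t₀) (𝓝 (∫ _z, φ x₀ ∂(stdGaussian (E D)))) := by
    refine tendsto_integral_filter_of_dominated_convergence (fun _ => ‖φ‖) ?_ ?_ ?_ ?_
    · exact Eventually.of_forall fun τ =>
        (φ.continuous.comp (by fun_prop)).aestronglyMeasurable
    · exact Eventually.of_forall fun τ => Eventually.of_forall fun z => φ.norm_coe_le_norm _
    · exact integrable_const _
    · refine Eventually.of_forall fun z => ?_
      refine (φ.continuous.tendsto x₀).comp ?_
      have := (hs₀.smul_const x₀).add ((hs₀.mul hσ₀).smul_const z)
      simpa using this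
  rw [integral_const, probReal_univ, one_smul] at h2
  refine h2.congr' ?_
  filter_upwards [self_mem_nhdsWithin] with τ hτ
  exact (h1 τ hτ).symm


/-! ### The Gaussian channel with an arbitrary input law -/

/-- The Gaussian likelihood, up to normalization, of the signal `x'` in the channel
`y = a x + z` with unit noise `z`, at the observation produced by the signal `x`. -/
noncomputable def channelWeight {D : ℕ} (a : ℝ) (x z x' : E D) : ℝ :=
  Real.exp (-‖a • (x - x') + z‖ ^ 2 / 2)

/-- The likelihood of the observation `a x + z`, up to normalization, when the signal has law `P`. -/
noncomputable def channelEvidence {D : ℕ} (P : Measure (E D)) (a : ℝ) (x z : E D) : ℝ :=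
  ∫ x', channelWeight a x z x' ∂P

/-- Minus the derivative in `a` of `channelEvidence P a x z`. -/
noncomputable def channelScore {D : ℕ} (P : Measure (E D)) (a : ℝ) (x z : E D) : ℝ :=
  ∫ x', channelWeight a x z x' * inner ℝ (a • (x - x') + z) (x - x') ∂P

section Pointwise

variable {D : ℕ}

theorem channelWeight_pos (a : ℝ) (x z x' : E D) : 0 < channelWeight a x z x' := Real.exp_pos _

theorem channelWeight_le_one (a : ℝ) (x z x' : E D) : channelWeight a x z x' ≤ 1 := by
  unfold channelWeight
  rw [Real.exp_le_one_iff]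
  have := sq_nonneg ‖a • (x - x') + z‖
  linarith

theorem channelWeight_mul_norm_sq_le (a : ℝ) (x z x' : E D) :
    channelWeight a x z x' * ‖a • (x - x') + z‖ ^ 2 ≤ 2 := by
  unfold channelWeight
  set r := ‖a • (x - x') + z‖ ^ 2
  have h := Real.add_one_le_exp (r / 2)
  have h2 : Real.exp (-r / 2) * Real.exp (r / 2) = 1 := by
    rw [← Real.exp_add, neg_div, neg_add_cancel, Real.exp_zero]
  nlinarith [Real.exp_pos (-r / 2)]

theorem norm_sub_le_of_pos {a : ℝ} (ha : 0 < a) (x z x' : E D) :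
    ‖x - x'‖ ≤ (‖a • (x - x') + z‖ + ‖z‖) / a := by
  rw [le_div_iff₀ ha]
  have h : ‖a • (x - x')‖ ≤ ‖a • (x - x') + z‖ + ‖z‖ := by
    simpa using norm_sub_le (a • (x - x') + z) z
  rwa [norm_smul, Real.norm_of_nonneg ha.le, mul_comm] at h

theorem abs_inner_channel_le {a : ℝ} (ha : 0 < a) (x z x' : E D) :
    |inner ℝ (a • (x - x') + z) (x - x')|
      ≤ 2 / a * (‖a • (x - x') + z‖ ^ 2 + ‖z‖ ^ 2) := by
  have h1 := abs_real_inner_le_norm (a • (x - x') + z) (x - x')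
  have h2 := norm_sub_le_of_pos ha x z x'
  have h3 : ‖a • (x - x') + z‖ * ‖x - x'‖
      ≤ ‖a • (x - x') + z‖ * ((‖a • (x - x') + z‖ + ‖z‖) / a) := by gcongr
  refine h1.trans (h3.trans ?_)
  rw [div_mul_eq_mul_div, mul_div_assoc']
  refine div_le_div_of_nonneg_right ?_ ha.le
  nlinarith [sq_nonneg (‖a • (x - x') + z‖ - ‖z‖), sq_nonneg ‖a • (x - x') + z‖, sq_nonneg ‖z‖]

theorem abs_channelWeight_mul_inner_le {a : ℝ} (ha : 0 < a) (x z x' : E D) :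
    |channelWeight a x z x' * inner ℝ (a • (x - x') + z) (x - x')|
      ≤ 2 / a * (2 + ‖z‖ ^ 2) := by
  have hw := channelWeight_pos a x z x'
  rw [abs_mul, abs_of_pos hw]
  calc channelWeight a x z x' * |inner ℝ (a • (x - x') + z) (x - x')|
      ≤ channelWeight a x z x' * (2 / a * (‖a • (x - x') + z‖ ^ 2 + ‖z‖ ^ 2)) := by
        gcongr; exact abs_inner_channel_le ha x z x'
    _ = 2 / a * (channelWeight a x z x' * ‖a • (x - x') + z‖ ^ 2
          + channelWeight a x z x' * ‖z‖ ^ 2) := by ring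
    _ ≤ 2 / a * (2 + 1 * ‖z‖ ^ 2) := by
        gcongr
        · exact channelWeight_mul_norm_sq_le a x z x'
        · exact channelWeight_le_one a x z x'
    _ = _ := by ring

theorem hasDerivAt_channelWeight (a : ℝ) (x z x' : E D) :
    HasDerivAt (fun b => channelWeight b x z x')
      (-(channelWeight a x z x' * inner ℝ (a • (x - x') + z) (x - x'))) a := by
  have h1 : HasDerivAt (fun b : ℝ => b • (x - x') + z) (x - x') a := by
    simpa using ((hasDerivAt_id a).smul_const (x - x')).add_const z
  have h2 := (h1.norm_sq.neg.div_const 2).exp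
  refine h2.congr_deriv ?_
  simp only [channelWeight, Pi.neg_apply]
  ring

/-- For a true signal `x` and true noise `z`, the vector `a (x - x') + z` is the noise that a
candidate signal `x'` would need to explain the observation. Its square at gain `a` is controlled
by its square at a comparable gain `a₀`. -/
theorem norm_sq_channel_le {a a₀ : ℝ} (ha₀ : 0 < a₀) (ha : 0 < a) (hle : a ≤ 2 * a₀)
    (x z x' : E D) :
    ‖a • (x - x') + z‖ ^ 2 ≤ 8 * ‖a₀ • (x - x') + z‖ ^ 2 + 2 * ‖z‖ ^ 2 := by
  have hl : 0 < a / a₀ := div_pos ha ha₀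
  have hl2 : a / a₀ ≤ 2 := by rw [div_le_iff₀ ha₀]; exact hle
  have e : a • (x - x') + z = (a / a₀) • (a₀ • (x - x') + z) + (1 - a / a₀) • z := by
    rw [smul_add, smul_smul, div_mul_cancel₀ _ ha₀.ne', sub_smul, one_smul]
    abel
  have h1 : ‖a • (x - x') + z‖ ≤ 2 * ‖a₀ • (x - x') + z‖ + ‖z‖ := by
    rw [e]
    refine (norm_add_le _ _).trans ?_
    rw [norm_smul, norm_smul, Real.norm_of_nonneg hl.le, Real.norm_eq_abs]
    have h3 : |1 - a / a₀| ≤ 1 := by rw [abs_le]; constructor <;> linarith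
    have := norm_nonneg z
    have := norm_nonneg (a₀ • (x - x') + z)
    nlinarith
  have h0 := norm_nonneg (a • (x - x') + z)
  nlinarith [sq_nonneg (2 * ‖a₀ • (x - x') + z‖ - ‖z‖)]

theorem exp_mul_channelWeight_pow_le {a a₀ : ℝ} (ha₀ : 0 < a₀) (ha : 0 < a) (hle : a ≤ 2 * a₀)
    (x z x' : E D) :
    Real.exp (-‖z‖ ^ 2) * channelWeight a₀ x z x' ^ 8 ≤ channelWeight a x z x' := by
  unfold channelWeight
  rw [← Real.exp_nat_mul, ← Real.exp_add, Real.exp_le_exp]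
  have := norm_sq_channel_le ha₀ ha hle x z x'
  push_cast
  linarith

theorem measurable_channelWeight (a : ℝ) :
    Measurable fun q : (E D × E D) × E D => channelWeight a q.1.1 q.1.2 q.2 := by
  unfold channelWeight
  fun_prop

theorem measurable_channelWeight_right (a : ℝ) (x z : E D) :
    Measurable fun x' : E D => channelWeight a x z x' := by
  unfold channelWeight
  fun_prop

end Pointwise

section Evidence

variable {D : ℕ} (P : Measure (E D)) [IsProbabilityMeasure P]

theorem integrable_channelWeight (a : ℝ) (x z : E D) :
    Integrable (fun x' => channelWeight a x z x') P := by
  refine Integrable.of_bound (measurable_channelWeight_right a x z).aestronglyMeasurable 1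
    (Eventually.of_forall fun x' => ?_)
  rw [Real.norm_of_nonneg (channelWeight_pos a x z x').le]
  exact channelWeight_le_one a x z x'

theorem channelEvidence_pos (a : ℝ) (x z : E D) : 0 < channelEvidence P a x z := by
  refine (integral_pos_iff_support_of_nonneg (fun x' => (channelWeight_pos a x z x').le)
    (integrable_channelWeight P a x z)).2 ?_
  have : Function.support (fun x' => channelWeight a x z x') = Set.univ :=
    Set.eq_univ_of_forall fun x' => (channelWeight_pos a x z x').ne'
  simp [this]

theorem channelEvidence_le_one (a : ℝ) (x z : E D) : channelEvidence P a x z ≤ 1 := by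
  refine (integral_mono (integrable_channelWeight P a x z) (integrable_const 1)
    (channelWeight_le_one a x z)).trans ?_
  simp

theorem integrable_channelWeight_mul_norm_sq (a : ℝ) (x z : E D) :
    Integrable (fun x' => channelWeight a x z x' * ‖a • (x - x') + z‖ ^ 2) P := by
  refine Integrable.of_bound (((measurable_channelWeight_right a x z).mul
    (by fun_prop)).aestronglyMeasurable) 2 (Eventually.of_forall fun x' => ?_)
  rw [Real.norm_of_nonneg (mul_nonneg (channelWeight_pos a x z x').le (sq_nonneg _))]
  exact channelWeight_mul_norm_sq_le a x z x'

theorem integrable_channelWeight_mul_inner {a : ℝ} (ha : 0 < a) (x z : E D) :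
    Integrable (fun x' => channelWeight a x z x' * inner ℝ (a • (x - x') + z) (x - x')) P := by
  refine Integrable.of_bound (((measurable_channelWeight_right a x z).mul
    (by fun_prop)).aestronglyMeasurable) (2 / a * (2 + ‖z‖ ^ 2)) (Eventually.of_forall fun x' => ?_)
  exact abs_channelWeight_mul_inner_le ha x z x'

theorem hasDerivAt_channelEvidence {a : ℝ} (ha : 0 < a) (x z : E D) :
    HasDerivAt (fun b => channelEvidence P b x z) (-channelScore P a x z) a := by
  unfold channelEvidence channelScore
  rw [← integral_neg]
  refine (hasDerivAt_integral_of_dominated_loc_of_deriv_le (s := Set.Ioi (a / 2))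
    (F' := fun b x' => -(channelWeight b x z x' * inner ℝ (b • (x - x') + z) (x - x')))
    (bound := fun _ => 2 / (a / 2) * (2 + ‖z‖ ^ 2))
    (Ioi_mem_nhds (by linarith)) ?_ (integrable_channelWeight P a x z)
    (integrable_channelWeight_mul_inner P ha x z).neg.aestronglyMeasurable ?_
    (integrable_const _) ?_).2
  · exact Eventually.of_forall fun b =>
      (measurable_channelWeight_right b x z).aestronglyMeasurable
  · refine Eventually.of_forall fun x' b hb => ?_
    have hb' : a / 2 < b := hb
    rw [norm_neg, Real.norm_eq_abs]
    refine (abs_channelWeight_mul_inner_le (by linarith) x z x').trans ?_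
    gcongr
  · exact Eventually.of_forall fun x' b _ => hasDerivAt_channelWeight b x z x'

/-- The posterior mean of the squared noise is at most `-4` times the log-evidence. This is the
Gibbs variational inequality for the exponent `‖w‖² / 4`, obtained by integrating a tangent line
of the exponential function. -/
theorem integral_channelWeight_mul_norm_sq_le (a : ℝ) (x z : E D) :
    ∫ x', channelWeight a x z x' * ‖a • (x - x') + z‖ ^ 2 ∂P
      ≤ channelEvidence P a x z * (-4 * Real.log (channelEvidence P a x z)) := by
  set L := channelEvidence P a x z with hL
  have hL0 : 0 < L := channelEvidence_pos P a x z
  have key : ∀ x', channelWeight a x z x' * ‖a • (x - x') + z‖ ^ 2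
      ≤ 4 * (-Real.log L - 1) * channelWeight a x z x' + 4 * L := by
    intro x'
    unfold channelWeight
    set r := ‖a • (x - x') + z‖ ^ 2 with hr
    -- the tangent line at `r / 4 = -log L`, which makes the two error terms cancel on average
    have h := Real.add_one_le_exp (r / 4 + Real.log L)
    rw [Real.exp_add, Real.exp_log hL0] at h
    have h2 : Real.exp (-r / 2) * Real.exp (r / 4) ≤ 1 := by
      rw [← Real.exp_add, Real.exp_le_one_iff]
      have : 0 ≤ r := sq_nonneg _
      linarith
    have h3 := mul_le_mul_of_nonneg_left h (Real.exp_pos (-r / 2)).le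
    nlinarith
  refine (integral_mono (integrable_channelWeight_mul_norm_sq P a x z)
    (((integrable_channelWeight P a x z).const_mul _).add (integrable_const _)) key).trans ?_
  simp only [Pi.add_apply]
  rw [integral_add ((integrable_channelWeight P a x z).const_mul _) (integrable_const _),
    integral_const_mul, integral_const, probReal_univ, one_smul]
  change 4 * (-Real.log L - 1) * L + 4 * L ≤ _
  linarith

theorem abs_channelScore_div_le {a : ℝ} (ha : 0 < a) (x z : E D) :
    |channelScore P a x z / channelEvidence P a x z|
      ≤ 2 / a * (-4 * Real.log (channelEvidence P a x z) + ‖z‖ ^ 2) := by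
  have hL := channelEvidence_pos P a x z
  rw [abs_div, abs_of_pos hL, div_le_iff₀ hL]
  have h1 : |channelScore P a x z| ≤ ∫ x', 2 / a * (channelWeight a x z x' *
      ‖a • (x - x') + z‖ ^ 2 + channelWeight a x z x' * ‖z‖ ^ 2) ∂P := by
    refine abs_integral_le_integral_abs.trans (integral_mono
      (integrable_channelWeight_mul_inner P ha x z).abs
      (((integrable_channelWeight_mul_norm_sq P a x z).add
        ((integrable_channelWeight P a x z).mul_const _)).const_mul _) fun x' => ?_)
    have hw := channelWeight_pos a x z x'
    simp only
    rw [abs_mul, abs_of_pos hw]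
    calc channelWeight a x z x' * |inner ℝ (a • (x - x') + z) (x - x')|
        ≤ channelWeight a x z x' * (2 / a * (‖a • (x - x') + z‖ ^ 2 + ‖z‖ ^ 2)) := by
          gcongr; exact abs_inner_channel_le ha x z x'
      _ = _ := by ring
  refine h1.trans ?_
  rw [integral_const_mul, integral_add (integrable_channelWeight_mul_norm_sq P a x z)
    ((integrable_channelWeight P a x z).mul_const _), integral_mul_const, mul_assoc]
  change 2 / a * (_ + channelEvidence P a x z * ‖z‖ ^ 2) ≤ _
  have h2 := integral_channelWeight_mul_norm_sq_le P a x z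
  have h3 : (-4 * Real.log (channelEvidence P a x z) + ‖z‖ ^ 2) * channelEvidence P a x z
      = channelEvidence P a x z * (-4 * Real.log (channelEvidence P a x z))
        + channelEvidence P a x z * ‖z‖ ^ 2 := by ring
  rw [h3]
  gcongr

/-- A Harnack-type comparison of the evidence at different gains. It makes the bound on the
score locally uniform in the gain while only the evidence at `a₀` is assumed log-integrable. -/
theorem neg_log_channelEvidence_le {a a₀ : ℝ} (ha₀ : 0 < a₀) (ha : 0 < a) (hle : a ≤ 2 * a₀)
    (x z : E D) :
    -Real.log (channelEvidence P a x z)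
      ≤ ‖z‖ ^ 2 - 8 * Real.log (channelEvidence P a₀ x z) := by
  have hint8 : Integrable (fun x' => channelWeight a₀ x z x' ^ 8) P := by
    refine Integrable.of_bound
      ((measurable_channelWeight_right a₀ x z).pow_const 8).aestronglyMeasurable 1
      (Eventually.of_forall fun x' => ?_)
    have hw := (channelWeight_pos a₀ x z x').le
    rw [Real.norm_of_nonneg (pow_nonneg hw 8)]
    exact pow_le_one₀ hw (channelWeight_le_one a₀ x z x')
  -- Jensen's inequality turns the eighth power of the weight into one of the evidence
  have h1 : channelEvidence P a₀ x z ^ 8 ≤ ∫ x', channelWeight a₀ x z x' ^ 8 ∂P :=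
    (convexOn_pow 8).map_integral_le (continuous_pow 8).continuousOn isClosed_Ici
      (Eventually.of_forall fun x' => (channelWeight_pos a₀ x z x').le)
      (integrable_channelWeight P a₀ x z) hint8
  have h2 : Real.exp (-‖z‖ ^ 2) * ∫ x', channelWeight a₀ x z x' ^ 8 ∂P
      ≤ channelEvidence P a x z := by
    rw [← integral_const_mul]
    exact integral_mono (hint8.const_mul _) (integrable_channelWeight P a x z)
      fun x' => exp_mul_channelWeight_pow_le ha₀ ha hle x z x'
  have h3 : Real.exp (-‖z‖ ^ 2) * channelEvidence P a₀ x z ^ 8 ≤ channelEvidence P a x z :=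
    le_trans (by gcongr) h2
  have hL0 := channelEvidence_pos P a₀ x z
  have h4 := Real.log_le_log (by positivity) h3
  rw [Real.log_mul (Real.exp_pos _).ne' (by positivity), Real.log_exp, Real.log_pow] at h4
  push_cast at h4
  linarith

theorem measurable_channelEvidence (a : ℝ) :
    Measurable fun q : E D × E D => channelEvidence P a q.1 q.2 :=
  (measurable_channelWeight a).stronglyMeasurable.integral_prod_right.measurable

theorem measurable_channelScore (a : ℝ) :
    Measurable fun q : E D × E D => channelScore P a q.1 q.2 := by
  have h : Measurable fun q : (E D × E D) × E D => channelWeight a q.1.1 q.1.2 q.2 *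
      inner ℝ (a • (q.1.1 - q.2) + q.1.2) (q.1.1 - q.2) :=
    (measurable_channelWeight a).mul (by fun_prop)
  exact h.stronglyMeasurable.integral_prod_right.measurable

theorem integrable_norm_sq_stdGaussian :
    Integrable (fun z : E D => ‖z‖ ^ 2) (stdGaussian (E D)) :=
  (IsGaussian.memLp_two_id (μ := stdGaussian (E D))).integrable_norm_pow (by norm_num)

/-- The expected log-evidence can be differentiated under the expectation at every gain at which
it is finite; no moment of `P` is needed. -/
theorem hasDerivAt_integral_neg_log_channelEvidence {a₀ : ℝ} (ha₀ : 0 < a₀)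
    (hint : Integrable (fun q : E D × E D => Real.log (channelEvidence P a₀ q.1 q.2))
      (P.prod (stdGaussian (E D)))) :
    Integrable (fun q : E D × E D => channelScore P a₀ q.1 q.2 / channelEvidence P a₀ q.1 q.2)
      (P.prod (stdGaussian (E D))) ∧
    HasDerivAt (fun a => ∫ q, -Real.log (channelEvidence P a q.1 q.2)
        ∂(P.prod (stdGaussian (E D))))
      (∫ q, channelScore P a₀ q.1 q.2 / channelEvidence P a₀ q.1 q.2
        ∂(P.prod (stdGaussian (E D)))) a₀ := by
  have hz : Integrable (fun q : E D × E D => ‖q.2‖ ^ 2) (P.prod (stdGaussian (E D))) :=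
    integrable_norm_sq_stdGaussian.comp_snd P
  refine hasDerivAt_integral_of_dominated_loc_of_deriv_le (s := Set.Ioo (a₀ / 2) (2 * a₀))
    (F := fun a (q : E D × E D) => -Real.log (channelEvidence P a q.1 q.2))
    (F' := fun a (q : E D × E D) => channelScore P a q.1 q.2 / channelEvidence P a q.1 q.2)
    (bound := fun q => 2 / (a₀ / 2) *
      (4 * (‖q.2‖ ^ 2 - 8 * Real.log (channelEvidence P a₀ q.1 q.2)) + ‖q.2‖ ^ 2))
    (Ioo_mem_nhds (by linarith) (by linarith)) ?_ hint.neg ?_ ?_ ?_ ?_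
  · exact Eventually.of_forall fun a =>
      (measurable_channelEvidence P a).log.neg.aestronglyMeasurable
  · exact ((measurable_channelScore P a₀).div
      (measurable_channelEvidence P a₀)).aestronglyMeasurable
  · refine Eventually.of_forall fun q a ha => ?_
    have ha' : 0 < a := by linarith [ha.1]
    have h1 := neg_log_channelEvidence_le P ha₀ ha' ha.2.le q.1 q.2
    rw [Real.norm_eq_abs]
    refine (abs_channelScore_div_le P ha' q.1 q.2).trans ?_
    have h2 : 0 ≤ -Real.log (channelEvidence P a q.1 q.2) := by
      have := Real.log_nonpos (channelEvidence_pos P a q.1 q.2).le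
        (channelEvidence_le_one P a q.1 q.2)
      linarith
    have h3 : 2 / a ≤ 2 / (a₀ / 2) := by
      have := ha.1.le
      gcongr
    have h4 : 0 ≤ -4 * Real.log (channelEvidence P a q.1 q.2) + ‖q.2‖ ^ 2 := by
      have := sq_nonneg ‖q.2‖
      linarith
    exact mul_le_mul h3 (by linarith) h4 (by positivity)
  · exact ((((hz.sub (hint.const_mul 8)).const_mul 4).add hz).const_mul _)
  · refine Eventually.of_forall fun q a ha => ?_
    have ha' : 0 < a := by linarith [ha.1]
    have hL := channelEvidence_pos P a q.1 q.2
    refine ((hasDerivAt_channelEvidence P ha' q.1 q.2).log hL.ne').neg.congr_deriv ?_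
    ring

end Evidence


/-! ### The joint law and the posterior law -/

section Laws

variable {D : ℕ} {ν : Measure (E D)} {p₀ : E D → ℝ} {s σ : ℝ → ℝ} {t : ℝ}

theorem integral_dataLaw {F : Type*} [NormedAddCommGroup F] [NormedSpace ℝ F]
    (hp : Measurable p₀) (hp' : ∀ x, 0 ≤ p₀ x) (f : E D → F) :
    ∫ x, f x ∂(dataLaw ν p₀) = ∫ x, p₀ x • f x ∂ν := by
  rw [dataLaw, integral_withDensity_eq_integral_toReal_smul hp.ennreal_ofReal (by simp)]
  simp only [ENNReal.toReal_ofReal (hp' _)]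

theorem integrable_dataLaw_iff {F : Type*} [NormedAddCommGroup F] [NormedSpace ℝ F]
    (hp : Measurable p₀) (hp' : ∀ x, 0 ≤ p₀ x) (f : E D → F) :
    Integrable f (dataLaw ν p₀) ↔ Integrable (fun x => p₀ x • f x) ν := by
  rw [dataLaw, integrable_withDensity_iff_integrable_smul' hp.ennreal_ofReal (by simp)]
  simp only [ENNReal.toReal_ofReal (hp' _)]

theorem jointLaw_eq_withDensity_dataLaw [SigmaFinite ν] (hp : Measurable p₀)
    (hs : 0 < s t) (hσ : 0 < σ t) :
    jointLaw ν p₀ s σ t = ((dataLaw ν p₀).prod volume).withDensity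
      fun z => ENNReal.ofReal (forwardDensity s σ t z.1 z.2) := by
  rw [dataLaw, prod_withDensity_left hp.ennreal_ofReal, jointLaw,
    ← withDensity_mul _ (by fun_prop) (measurable_forwardDensity s σ t).ennreal_ofReal]
  congr 1
  funext z
  rw [Pi.mul_apply, ENNReal.ofReal_mul (forwardDensity_pos hs hσ _ _).le, mul_comm]

theorem lintegral_jointLaw [SigmaFinite ν] [IsProbabilityMeasure (dataLaw ν p₀)]
    (hp : Measurable p₀) (hs : 0 < s t) (hσ : 0 < σ t) {h : E D × E D → ℝ≥0∞}
    (hh : Measurable h) :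
    ∫⁻ z, h z ∂(jointLaw ν p₀ s σ t)
      = ∫⁻ y, ∫⁻ x, ENNReal.ofReal (forwardDensity s σ t x y) * h (x, y) ∂(dataLaw ν p₀) := by
  have hf := (measurable_forwardDensity (D := D) s σ t).ennreal_ofReal
  rw [jointLaw_eq_withDensity_dataLaw hp hs hσ, lintegral_withDensity_eq_lintegral_mul _ hf hh,
    lintegral_prod_symm' _ (hf.mul hh)]
  rfl

/-- The joint law of `(x_0, x_t)` is the law of `(x_0, s x_0 + s σ ε)`. -/
theorem jointLaw_eq_map [SigmaFinite ν] [IsProbabilityMeasure (dataLaw ν p₀)]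
    (hp : Measurable p₀) (hs : 0 < s t) (hσ : 0 < σ t) :
    jointLaw ν p₀ s σ t = ((dataLaw ν p₀).prod (stdGaussian (E D))).map
      fun z => (z.1, s t • z.1 + (s t * σ t) • z.2) := by
  have hf := (measurable_forwardDensity (D := D) s σ t).ennreal_ofReal
  have hg : Measurable fun z : E D × E D => (z.1, s t • z.1 + (s t * σ t) • z.2) := by fun_prop
  refine Measure.ext_of_lintegral _ fun h hh => ?_
  have hhg : Measurable fun z : E D × E D => h (z.1, s t • z.1 + (s t * σ t) • z.2) := hh.comp hg
  rw [lintegral_map hh hg, lintegral_prod _ hhg.aemeasurable,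
    jointLaw_eq_withDensity_dataLaw hp hs hσ, lintegral_withDensity_eq_lintegral_mul _ hf hh,
    lintegral_prod _ (hf.mul hh).aemeasurable]
  refine lintegral_congr fun x => ?_
  have hx : Measurable fun y => h (x, y) := hh.comp measurable_prodMk_left
  have ha : Measurable fun z : E D => s t • x + (s t * σ t) • z := by fun_prop
  have h1 := lintegral_map (μ := stdGaussian (E D)) hx ha
  rw [← withDensity_forwardDensity hs hσ x, lintegral_withDensity_eq_lintegral_mul _
    (measurable_forwardDensity_right s σ t x).ennreal_ofReal hx] at h1
  exact h1

theorem isProbabilityMeasure_jointLaw [SigmaFinite ν] [IsProbabilityMeasure (dataLaw ν p₀)]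
    (hp : Measurable p₀) (hs : 0 < s t) (hσ : 0 < σ t) :
    IsProbabilityMeasure (jointLaw ν p₀ s σ t) := by
  rw [jointLaw_eq_map hp hs hσ]
  exact Measure.isProbabilityMeasure_map (by fun_prop)

/-- After rescaling, `x_t` is the output of the Gaussian channel with gain `1 / σ`: the scale `s`
only enters through the normalizing constant. -/
theorem forwardDensity_eq_channelWeight (hs : 0 < s t) (hσ : 0 < σ t) (x z x' : E D) :
    forwardDensity s σ t x' (s t • x + (s t * σ t) • z)
      = (2 * Real.pi * (s t ^ 2 * σ t ^ 2)) ^ (-(D : ℝ) / 2)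
        * channelWeight (σ t)⁻¹ x z x' := by
  have e : s t • x + (s t * σ t) • z - s t • x'
      = (s t * σ t) • ((σ t)⁻¹ • (x - x') + z) := by
    rw [smul_add, smul_smul, mul_assoc, mul_inv_cancel₀ hσ.ne', mul_one, smul_sub]
    abel
  rw [forwardDensity, channelWeight, e, norm_smul, mul_pow, Real.norm_eq_abs, sq_abs]
  congr 2
  field_simp

/-- Every point `y` is the observation made when the signal is `0` and the noise `(s σ)⁻¹ y`. -/
theorem forwardDensity_eq_channelWeight_zero (hs : 0 < s t) (hσ : 0 < σ t) (y x' : E D) :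
    forwardDensity s σ t x' y
      = (2 * Real.pi * (s t ^ 2 * σ t ^ 2)) ^ (-(D : ℝ) / 2)
        * channelWeight (σ t)⁻¹ 0 ((s t * σ t)⁻¹ • y) x' := by
  rw [← forwardDensity_eq_channelWeight hs hσ, smul_zero, zero_add, smul_smul,
    mul_inv_cancel₀ (mul_pos hs hσ).ne', one_smul]

theorem marginalDensity_eq_integral_dataLaw (hp : Measurable p₀) (hp' : ∀ x, 0 ≤ p₀ x) (y : E D) :
    marginalDensity ν p₀ s σ t y = ∫ x, forwardDensity s σ t x y ∂(dataLaw ν p₀) := by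
  rw [integral_dataLaw hp hp', marginalDensity]
  simp only [smul_eq_mul, mul_comm]

theorem marginalDensity_eq_channelEvidence (hp : Measurable p₀) (hp' : ∀ x, 0 ≤ p₀ x)
    (hs : 0 < s t) (hσ : 0 < σ t) (x z : E D) :
    marginalDensity ν p₀ s σ t (s t • x + (s t * σ t) • z)
      = (2 * Real.pi * (s t ^ 2 * σ t ^ 2)) ^ (-(D : ℝ) / 2)
        * channelEvidence (dataLaw ν p₀) (σ t)⁻¹ x z := by
  rw [marginalDensity_eq_integral_dataLaw hp hp', channelEvidence, ← integral_const_mul]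
  simp only [forwardDensity_eq_channelWeight hs hσ]

theorem integrable_forwardDensity [IsProbabilityMeasure (dataLaw ν p₀)]
    (hs : 0 < s t) (hσ : 0 < σ t) (y : E D) :
    Integrable (fun x => forwardDensity s σ t x y) (dataLaw ν p₀) := by
  simp only [forwardDensity_eq_channelWeight_zero hs hσ]
  exact (integrable_channelWeight _ _ _ _).const_mul _

theorem marginalDensity_pos [IsProbabilityMeasure (dataLaw ν p₀)] (hp : Measurable p₀)
    (hp' : ∀ x, 0 ≤ p₀ x) (hs : 0 < s t) (hσ : 0 < σ t) (y : E D) :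
    0 < marginalDensity ν p₀ s σ t y := by
  have e : y = s t • (0 : E D) + (s t * σ t) • ((s t * σ t)⁻¹ • y) := by
    rw [smul_zero, zero_add, smul_smul, mul_inv_cancel₀ (mul_pos hs hσ).ne', one_smul]
  rw [e, marginalDensity_eq_channelEvidence hp hp' hs hσ]
  exact mul_pos (by positivity) (channelEvidence_pos _ _ _ _)

theorem measurable_marginalDensity [SigmaFinite ν] (hp : Measurable p₀) :
    Measurable (marginalDensity ν p₀ s σ t) := by
  have h : Measurable fun z : E D × E D => forwardDensity s σ t z.1 z.2 * p₀ z.1 :=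
    (measurable_forwardDensity s σ t).mul (by fun_prop)
  exact h.stronglyMeasurable.integral_prod_left'.measurable

theorem measurable_posteriorDensity [SigmaFinite ν] (hp : Measurable p₀) :
    Measurable fun z : E D × E D => posteriorDensity ν p₀ s σ t z.1 z.2 :=
  ((measurable_forwardDensity s σ t).mul (hp.comp measurable_fst)).div
    ((measurable_marginalDensity hp).comp measurable_snd)

theorem measurable_posteriorMean [SigmaFinite ν] (hp : Measurable p₀) :
    Measurable (posteriorMean ν p₀ s σ t) := by
  have h : Measurable fun z : E D × E D => posteriorDensity ν p₀ s σ t z.1 z.2 • z.1 :=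
    (measurable_posteriorDensity hp).smul measurable_fst
  exact h.stronglyMeasurable.integral_prod_left'.measurable

/-- The conditional law of `x_0` given `x_t = y`, as a measure with density with respect to the
law of `x_0`. -/
noncomputable def posteriorLaw (ν : Measure (E D)) (p₀ : E D → ℝ) (s σ : ℝ → ℝ) (t : ℝ)
    (y : E D) : Measure (E D) :=
  (dataLaw ν p₀).withDensity fun x =>
    ENNReal.ofReal (forwardDensity s σ t x y / marginalDensity ν p₀ s σ t y)

theorem measurable_forwardDensity_left (s σ : ℝ → ℝ) (t : ℝ) (y : E D) :
    Measurable fun x : E D => forwardDensity s σ t x y := by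
  unfold forwardDensity
  fun_prop

theorem integral_posteriorLaw {F : Type*} [NormedAddCommGroup F] [NormedSpace ℝ F]
    [IsProbabilityMeasure (dataLaw ν p₀)] (hp : Measurable p₀) (hp' : ∀ x, 0 ≤ p₀ x)
    (hs : 0 < s t) (hσ : 0 < σ t) (y : E D) (f : E D → F) :
    ∫ x, f x ∂(posteriorLaw ν p₀ s σ t y) = ∫ x,
      (forwardDensity s σ t x y / marginalDensity ν p₀ s σ t y) • f x ∂(dataLaw ν p₀) := by
  rw [posteriorLaw, integral_withDensity_eq_integral_toReal_smul
    ((measurable_forwardDensity_left s σ t y).div_const _).ennreal_ofReal (by simp)]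
  refine integral_congr_ae (Eventually.of_forall fun x => ?_)
  simp only
  rw [ENNReal.toReal_ofReal (div_pos (forwardDensity_pos hs hσ _ _)
    (marginalDensity_pos hp hp' hs hσ y)).le]

theorem integrable_posteriorLaw_iff {F : Type*} [NormedAddCommGroup F] [NormedSpace ℝ F]
    [IsProbabilityMeasure (dataLaw ν p₀)] (hp : Measurable p₀) (hp' : ∀ x, 0 ≤ p₀ x)
    (hs : 0 < s t) (hσ : 0 < σ t) (y : E D) (f : E D → F) :
    Integrable f (posteriorLaw ν p₀ s σ t y) ↔ Integrable (fun x =>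
      (forwardDensity s σ t x y / marginalDensity ν p₀ s σ t y) • f x) (dataLaw ν p₀) := by
  rw [posteriorLaw, integrable_withDensity_iff_integrable_smul'
    ((measurable_forwardDensity_left s σ t y).div_const _).ennreal_ofReal (by simp)]
  refine integrable_congr (Eventually.of_forall fun x => ?_)
  simp only
  rw [ENNReal.toReal_ofReal (div_pos (forwardDensity_pos hs hσ _ _)
    (marginalDensity_pos hp hp' hs hσ y)).le]

theorem isProbabilityMeasure_posteriorLaw [IsProbabilityMeasure (dataLaw ν p₀)]
    (hp : Measurable p₀) (hp' : ∀ x, 0 ≤ p₀ x) (hs : 0 < s t) (hσ : 0 < σ t) (y : E D) :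
    IsProbabilityMeasure (posteriorLaw ν p₀ s σ t y) := by
  have hq := marginalDensity_pos (ν := ν) hp hp' hs hσ y
  constructor
  rw [posteriorLaw, withDensity_apply _ MeasurableSet.univ, Measure.restrict_univ,
    ← ofReal_integral_eq_lintegral_ofReal ((integrable_forwardDensity hs hσ y).div_const _)
      (Eventually.of_forall fun x => (div_pos (forwardDensity_pos hs hσ _ _) hq).le),
    integral_div, ← marginalDensity_eq_integral_dataLaw hp hp', div_self hq.ne',
    ENNReal.ofReal_one]

/-- The posterior has a second moment, whatever the law of `x_0`, since the Gaussian likelihood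
decays faster than any power. -/
theorem memLp_two_posteriorLaw [IsProbabilityMeasure (dataLaw ν p₀)]
    (hp : Measurable p₀) (hp' : ∀ x, 0 ≤ p₀ x) (hs : 0 < s t) (hσ : 0 < σ t) (y : E D) :
    MemLp (fun x => x) 2 (posteriorLaw ν p₀ s σ t y) := by
  refine (memLp_two_iff_integrable_sq_norm (f := fun x : E D => x) aestronglyMeasurable_id).2 ?_
  rw [integrable_posteriorLaw_iff hp hp' hs hσ]
  set z : E D := (s t * σ t)⁻¹ • y with hz
  have hq := marginalDensity_pos (ν := ν) hp hp' hs hσ y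
  have ha : 0 < (σ t)⁻¹ := by positivity
  have h1 : Integrable (fun x' => channelWeight (σ t)⁻¹ 0 z x' * ‖x'‖ ^ 2) (dataLaw ν p₀) := by
    refine Integrable.mono' (((integrable_channelWeight_mul_norm_sq (dataLaw ν p₀) (σ t)⁻¹ 0 z).add
      ((integrable_channelWeight (dataLaw ν p₀) (σ t)⁻¹ 0 z).mul_const (‖z‖ ^ 2))).const_mul
        (2 / (σ t)⁻¹ ^ 2)) (((measurable_channelWeight_right _ _ _).mul
        (by fun_prop)).aestronglyMeasurable) (Eventually.of_forall fun x' => ?_)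
    have hw := channelWeight_pos (σ t)⁻¹ 0 z x'
    rw [Real.norm_of_nonneg (mul_nonneg hw.le (sq_nonneg _))]
    have h2 := norm_sub_le_of_pos ha 0 z x'
    rw [zero_sub, norm_neg] at h2
    have h3 : ‖x'‖ ^ 2 ≤ 2 / (σ t)⁻¹ ^ 2 * (‖(σ t)⁻¹ • (0 - x') + z‖ ^ 2 + ‖z‖ ^ 2) := by
      have h4 : ‖x'‖ ^ 2 ≤ ((‖(σ t)⁻¹ • (-x') + z‖ + ‖z‖) / (σ t)⁻¹) ^ 2 := by gcongr
      refine h4.trans ?_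
      rw [div_pow, zero_sub, div_mul_eq_mul_div]
      refine div_le_div_of_nonneg_right ?_ (by positivity)
      nlinarith [sq_nonneg (‖(σ t)⁻¹ • (-x') + z‖ - ‖z‖)]
    calc channelWeight (σ t)⁻¹ 0 z x' * ‖x'‖ ^ 2
        ≤ channelWeight (σ t)⁻¹ 0 z x' *
          (2 / (σ t)⁻¹ ^ 2 * (‖(σ t)⁻¹ • (0 - x') + z‖ ^ 2 + ‖z‖ ^ 2)) := by gcongr
      _ = _ := by simp only [Pi.add_apply]; ring
  refine (h1.const_mul ((2 * Real.pi * (s t ^ 2 * σ t ^ 2)) ^ (-(D : ℝ) / 2)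
    / marginalDensity ν p₀ s σ t y)).congr (Eventually.of_forall fun x => ?_)
  simp only [smul_eq_mul, forwardDensity_eq_channelWeight_zero hs hσ, ← hz]
  ring

theorem posteriorDensity_smul_eq {F : Type*} [AddCommMonoid F] [Module ℝ F] (x y : E D) (v : F) :
    posteriorDensity ν p₀ s σ t x y • v
      = p₀ x • ((forwardDensity s σ t x y / marginalDensity ν p₀ s σ t y) • v) := by
  rw [posteriorDensity, smul_smul]
  congr 1
  ring

theorem posteriorMean_eq_integral_posteriorLaw [IsProbabilityMeasure (dataLaw ν p₀)]
    (hp : Measurable p₀) (hp' : ∀ x, 0 ≤ p₀ x) (hs : 0 < s t) (hσ : 0 < σ t) (y : E D) :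
    posteriorMean ν p₀ s σ t y = ∫ x, x ∂(posteriorLaw ν p₀ s σ t y) := by
  rw [integral_posteriorLaw hp hp' hs hσ, integral_dataLaw hp hp', posteriorMean]
  simp only [posteriorDensity_smul_eq]

theorem integrable_id_posteriorLaw [IsProbabilityMeasure (dataLaw ν p₀)]
    (hp : Measurable p₀) (hp' : ∀ x, 0 ≤ p₀ x) (hs : 0 < s t) (hσ : 0 < σ t) (y : E D) :
    Integrable (fun x => x) (posteriorLaw ν p₀ s σ t y) := by
  have := isProbabilityMeasure_posteriorLaw (ν := ν) hp hp' hs hσ y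
  exact (memLp_two_posteriorLaw hp hp' hs hσ y).integrable (by norm_num)

theorem integrable_posteriorDensity_smul [IsProbabilityMeasure (dataLaw ν p₀)]
    (hp : Measurable p₀) (hp' : ∀ x, 0 ≤ p₀ x) (hs : 0 < s t) (hσ : 0 < σ t) (y : E D) :
    Integrable (fun x => posteriorDensity ν p₀ s σ t x y • x) ν := by
  simp only [posteriorDensity_smul_eq]
  rw [← integrable_dataLaw_iff hp hp', ← integrable_posteriorLaw_iff hp hp' hs hσ]
  exact integrable_id_posteriorLaw hp hp' hs hσ y

theorem integrable_norm_sub_sq_posteriorLaw [IsProbabilityMeasure (dataLaw ν p₀)]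
    (hp : Measurable p₀) (hp' : ∀ x, 0 ≤ p₀ x) (hs : 0 < s t) (hσ : 0 < σ t) (y c : E D) :
    Integrable (fun x => ‖x - c‖ ^ 2) (posteriorLaw ν p₀ s σ t y) := by
  have := isProbabilityMeasure_posteriorLaw (ν := ν) hp hp' hs hσ y
  have h : MemLp (fun x => x - c) 2 (posteriorLaw ν p₀ s σ t y) :=
    (memLp_two_posteriorLaw hp hp' hs hσ y).sub (memLp_const c)
  exact h.integrable_norm_pow (by norm_num)

theorem integral_sub_posteriorMean [IsProbabilityMeasure (dataLaw ν p₀)]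
    (hp : Measurable p₀) (hp' : ∀ x, 0 ≤ p₀ x) (hs : 0 < s t) (hσ : 0 < σ t) (y : E D) :
    ∫ x, (x - posteriorMean ν p₀ s σ t y) ∂(posteriorLaw ν p₀ s σ t y) = 0 := by
  have := isProbabilityMeasure_posteriorLaw (ν := ν) hp hp' hs hσ y
  rw [integral_sub (integrable_id_posteriorLaw hp hp' hs hσ y) (integrable_const _),
    integral_const, probReal_univ, one_smul, posteriorMean_eq_integral_posteriorLaw hp hp' hs hσ,
    sub_self]

theorem integral_inner_sub_posteriorMean [IsProbabilityMeasure (dataLaw ν p₀)]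
    (hp : Measurable p₀) (hp' : ∀ x, 0 ≤ p₀ x) (hs : 0 < s t) (hσ : 0 < σ t) (y b : E D) :
    Integrable (fun x => inner ℝ b (x - posteriorMean ν p₀ s σ t y))
      (posteriorLaw ν p₀ s σ t y) ∧
    ∫ x, inner ℝ b (x - posteriorMean ν p₀ s σ t y) ∂(posteriorLaw ν p₀ s σ t y) = 0 := by
  have := isProbabilityMeasure_posteriorLaw (ν := ν) hp hp' hs hσ y
  have h := (integrable_id_posteriorLaw hp hp' hs hσ y).sub
    (integrable_const (μ := posteriorLaw ν p₀ s σ t y) (posteriorMean ν p₀ s σ t y))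
  refine ⟨h.const_inner b, ?_⟩
  rw [integral_inner (f := fun x => x - posteriorMean ν p₀ s σ t y) h b,
    integral_sub_posteriorMean hp hp' hs hσ, inner_zero_right]

/-- The bias–variance decomposition under the posterior. -/
theorem integral_norm_sub_sq_posteriorLaw [IsProbabilityMeasure (dataLaw ν p₀)]
    (hp : Measurable p₀) (hp' : ∀ x, 0 ≤ p₀ x) (hs : 0 < s t) (hσ : 0 < σ t) (y c : E D) :
    ∫ x, ‖x - c‖ ^ 2 ∂(posteriorLaw ν p₀ s σ t y)
      = ∫ x, ‖x - posteriorMean ν p₀ s σ t y‖ ^ 2 ∂(posteriorLaw ν p₀ s σ t y)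
        + ‖posteriorMean ν p₀ s σ t y - c‖ ^ 2 := by
  have := isProbabilityMeasure_posteriorLaw (ν := ν) hp hp' hs hσ y
  set m := posteriorMean ν p₀ s σ t y with hm
  obtain ⟨h1, h2⟩ := integral_inner_sub_posteriorMean (ν := ν) hp hp' hs hσ y ((2 : ℝ) • (m - c))
  have h3 := integrable_norm_sub_sq_posteriorLaw (ν := ν) hp hp' hs hσ y m
  have e : ∀ x, ‖x - c‖ ^ 2 = ‖x - m‖ ^ 2 + inner ℝ ((2 : ℝ) • (m - c)) (x - m) + ‖m - c‖ ^ 2 := by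
    intro x
    rw [show x - c = (x - m) + (m - c) by abel, norm_add_sq_real, real_inner_smul_left,
      real_inner_comm]
  rw [← hm] at h1 h2
  have h4 : Integrable (fun x => ‖x - m‖ ^ 2 + inner ℝ ((2 : ℝ) • (m - c)) (x - m))
    (posteriorLaw ν p₀ s σ t y) := h3.add h1
  rw [integral_congr_ae (Eventually.of_forall e), integral_add h4 (integrable_const _), integral_add h3 h1, h2, integral_const,
    probReal_univ, one_smul, add_zero]

theorem lintegral_norm_sub_posteriorMean_sq_le [IsProbabilityMeasure (dataLaw ν p₀)]
    (hp : Measurable p₀) (hp' : ∀ x, 0 ≤ p₀ x) (hs : 0 < s t) (hσ : 0 < σ t) (y c : E D) :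
    ∫⁻ x, ENNReal.ofReal (‖x - posteriorMean ν p₀ s σ t y‖ ^ 2) ∂(posteriorLaw ν p₀ s σ t y)
      ≤ ∫⁻ x, ENNReal.ofReal (‖x - c‖ ^ 2) ∂(posteriorLaw ν p₀ s σ t y) := by
  rw [← ofReal_integral_eq_lintegral_ofReal
      (integrable_norm_sub_sq_posteriorLaw hp hp' hs hσ y _)
      (Eventually.of_forall fun _ => sq_nonneg _),
    ← ofReal_integral_eq_lintegral_ofReal
      (integrable_norm_sub_sq_posteriorLaw hp hp' hs hσ y _)
      (Eventually.of_forall fun _ => sq_nonneg _)]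
  refine ENNReal.ofReal_le_ofReal ?_
  rw [integral_norm_sub_sq_posteriorLaw hp hp' hs hσ y c]
  have := sq_nonneg ‖posteriorMean ν p₀ s σ t y - c‖
  linarith

/-- Disintegration of the joint law along `x_t`. -/
theorem lintegral_jointLaw_eq_lintegral_posteriorLaw [SigmaFinite ν]
    [IsProbabilityMeasure (dataLaw ν p₀)] (hp : Measurable p₀) (hp' : ∀ x, 0 ≤ p₀ x)
    (hs : 0 < s t) (hσ : 0 < σ t) {h : E D × E D → ℝ≥0∞} (hh : Measurable h) :
    ∫⁻ z, h z ∂(jointLaw ν p₀ s σ t) = ∫⁻ y, ENNReal.ofReal (marginalDensity ν p₀ s σ t y) *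
      ∫⁻ x, h (x, y) ∂(posteriorLaw ν p₀ s σ t y) := by
  rw [lintegral_jointLaw hp hs hσ hh]
  refine lintegral_congr fun y => ?_
  have hq := marginalDensity_pos (ν := ν) hp hp' hs hσ y
  have hy : Measurable fun x => h (x, y) := hh.comp measurable_prodMk_right
  have hw := ((measurable_forwardDensity_left s σ t y).div_const
    (marginalDensity ν p₀ s σ t y)).ennreal_ofReal
  rw [posteriorLaw, lintegral_withDensity_eq_lintegral_mul _ hw hy,
    ← lintegral_const_mul _ (hw.mul hy)]
  refine lintegral_congr fun x => ?_
  rw [Pi.mul_apply, ← mul_assoc, ← ENNReal.ofReal_mul hq.le, mul_div_cancel₀ _ hq.ne']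

theorem map_snd_jointLaw [SigmaFinite ν] [IsProbabilityMeasure (dataLaw ν p₀)]
    (hp : Measurable p₀) (hp' : ∀ x, 0 ≤ p₀ x) (hs : 0 < s t) (hσ : 0 < σ t) :
    (jointLaw ν p₀ s σ t).map Prod.snd = marginalLaw ν p₀ s σ t := by
  refine Measure.ext_of_lintegral _ fun h hh => ?_
  have hh2 : Measurable fun z : E D × E D => h z.2 := hh.comp measurable_snd
  rw [lintegral_map hh measurable_snd,
    lintegral_jointLaw_eq_lintegral_posteriorLaw hp hp' hs hσ hh2,
    marginalLaw, lintegral_withDensity_eq_lintegral_mul _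
      (measurable_marginalDensity hp).ennreal_ofReal hh]
  refine lintegral_congr fun y => ?_
  have := isProbabilityMeasure_posteriorLaw (ν := ν) hp hp' hs hσ y
  simp

end Laws


/-! ### The minimum mean squared error -/

section MMSE

variable {D : ℕ} {ν : Measure (E D)} {p₀ : E D → ℝ} {s σ : ℝ → ℝ} {t : ℝ}

theorem estimatorError_eq [SigmaFinite ν] [IsProbabilityMeasure (dataLaw ν p₀)]
    (hp : Measurable p₀) (hp' : ∀ x, 0 ≤ p₀ x) (hs : 0 < s t) (hσ : 0 < σ t)
    {xhat : E D → E D} (hx : Measurable xhat) :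
    estimatorError ν p₀ s σ t xhat = ∫⁻ y, ENNReal.ofReal (marginalDensity ν p₀ s σ t y) *
      ∫⁻ x, ENNReal.ofReal (‖x - xhat y‖ ^ 2) ∂(posteriorLaw ν p₀ s σ t y) := by
  have h : Measurable fun z : E D × E D => ENNReal.ofReal (‖z.1 - xhat z.2‖ ^ 2) := by fun_prop
  exact lintegral_jointLaw_eq_lintegral_posteriorLaw hp hp' hs hσ h

theorem estimatorError_posteriorMean_le [SigmaFinite ν] [IsProbabilityMeasure (dataLaw ν p₀)]
    (hp : Measurable p₀) (hp' : ∀ x, 0 ≤ p₀ x) (hs : 0 < s t) (hσ : 0 < σ t)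
    {xhat : E D → E D} (hx : Measurable xhat) :
    estimatorError ν p₀ s σ t (posteriorMean ν p₀ s σ t) ≤ estimatorError ν p₀ s σ t xhat := by
  rw [estimatorError_eq (ν := ν) hp hp' hs hσ hx,
    estimatorError_eq (ν := ν) hp hp' hs hσ (measurable_posteriorMean (ν := ν) hp)]
  refine lintegral_mono fun y => mul_le_mul' le_rfl ?_
  exact lintegral_norm_sub_posteriorMean_sq_le hp hp' hs hσ y (xhat y)

/-- The estimator `x_t / s` has mean squared error `σ² E ‖ε‖²`, so the minimum mean squared error
is finite even when `x_0` has no second moment. -/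
theorem estimatorError_posteriorMean_ne_top [SigmaFinite ν] [IsProbabilityMeasure (dataLaw ν p₀)]
    (hp : Measurable p₀) (hp' : ∀ x, 0 ≤ p₀ x) (hs : 0 < s t) (hσ : 0 < σ t) :
    estimatorError ν p₀ s σ t (posteriorMean ν p₀ s σ t) ≠ ⊤ := by
  have hx : Measurable fun y : E D => (s t)⁻¹ • y := by fun_prop
  refine ne_top_of_le_ne_top ?_ (estimatorError_posteriorMean_le hp hp' hs hσ hx)
  have h : Measurable fun z : E D × E D => ENNReal.ofReal (‖z.1 - (s t)⁻¹ • z.2‖ ^ 2) := by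
    fun_prop
  rw [estimatorError, jointLaw_eq_map hp hs hσ, lintegral_map h (by fun_prop)]
  have hz : Integrable (fun q : E D × E D => σ t ^ 2 * ‖q.2‖ ^ 2)
      ((dataLaw ν p₀).prod (stdGaussian (E D))) :=
    (integrable_norm_sq_stdGaussian.comp_snd (dataLaw ν p₀)).const_mul _
  have e : ∀ q : E D × E D, ENNReal.ofReal
      (‖q.1 - (s t)⁻¹ • (s t • q.1 + (s t * σ t) • q.2)‖ ^ 2)
      = ENNReal.ofReal (σ t ^ 2 * ‖q.2‖ ^ 2) := by
    intro q
    rw [smul_add, smul_smul, smul_smul, inv_mul_cancel₀ hs.ne', one_smul, ← mul_assoc,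
      inv_mul_cancel₀ hs.ne', one_mul, sub_add_cancel_left, norm_neg, norm_smul, mul_pow,
      Real.norm_eq_abs, sq_abs]
  rw [lintegral_congr e]
  exact ((hasFiniteIntegral_iff_ofReal (Eventually.of_forall fun q => by positivity)).1 hz.2).ne

theorem integrable_norm_sub_posteriorMean_sq [SigmaFinite ν]
    [IsProbabilityMeasure (dataLaw ν p₀)]
    (hp : Measurable p₀) (hp' : ∀ x, 0 ≤ p₀ x) (hs : 0 < s t) (hσ : 0 < σ t) :
    Integrable (fun z : E D × E D => ‖z.1 - posteriorMean ν p₀ s σ t z.2‖ ^ 2)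
      (jointLaw ν p₀ s σ t) := by
  have hm : Measurable fun z : E D × E D => ‖z.1 - posteriorMean ν p₀ s σ t z.2‖ ^ 2 :=
    (measurable_fst.sub ((measurable_posteriorMean hp).comp measurable_snd)).norm.pow_const 2
  refine ⟨hm.aestronglyMeasurable, ?_⟩
  rw [hasFiniteIntegral_iff_ofReal (Eventually.of_forall fun q => sq_nonneg _)]
  exact (estimatorError_posteriorMean_ne_top hp hp' hs hσ).lt_top

theorem ofReal_sqError [SigmaFinite ν] [IsProbabilityMeasure (dataLaw ν p₀)]
    (hp : Measurable p₀) (hp' : ∀ x, 0 ≤ p₀ x) (hs : 0 < s t) (hσ : 0 < σ t) :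
    ENNReal.ofReal (sqError ν p₀ s σ t)
      = estimatorError ν p₀ s σ t (posteriorMean ν p₀ s σ t) :=
  ofReal_integral_eq_lintegral_ofReal (integrable_norm_sub_posteriorMean_sq hp hp' hs hσ)
    (Eventually.of_forall fun _ => sq_nonneg _)

theorem sqError_nonneg (ν : Measure (E D)) (p₀ : E D → ℝ) (s σ : ℝ → ℝ) (t : ℝ) :
    0 ≤ sqError ν p₀ s σ t :=
  integral_nonneg fun _ => sq_nonneg _

theorem isLeast_estimatorError [SigmaFinite ν] [IsProbabilityMeasure (dataLaw ν p₀)]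
    (hp : Measurable p₀) (hp' : ∀ x, 0 ≤ p₀ x) (hs : 0 < s t) (hσ : 0 < σ t) :
    IsLeast {r : ℝ≥0∞ | ∃ xhat : E D → E D, Measurable xhat ∧
        r = estimatorError ν p₀ s σ t xhat} (ENNReal.ofReal (sqError ν p₀ s σ t)) := by
  rw [ofReal_sqError hp hp' hs hσ]
  refine ⟨⟨_, measurable_posteriorMean hp, rfl⟩, ?_⟩
  rintro r ⟨xhat, hx, rfl⟩
  exact estimatorError_posteriorMean_le hp hp' hs hσ hx

/-- The error of the posterior mean is orthogonal to every function of the observation. -/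
theorem integral_inner_sub_posteriorMean_jointLaw [SigmaFinite ν]
    [IsProbabilityMeasure (dataLaw ν p₀)]
    (hp : Measurable p₀) (hp' : ∀ x, 0 ≤ p₀ x) (hs : 0 < s t) (hσ : 0 < σ t) {b : E D → E D}
    (hint : Integrable (fun z : E D × E D => inner ℝ (b z.2) (z.1 - posteriorMean ν p₀ s σ t z.2))
      (jointLaw ν p₀ s σ t)) :
    ∫ z, inner ℝ (b z.2) (z.1 - posteriorMean ν p₀ s σ t z.2) ∂(jointLaw ν p₀ s σ t) = 0 := by
  have hf := (measurable_forwardDensity (D := D) s σ t).ennreal_ofReal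
  rw [jointLaw_eq_withDensity_dataLaw hp hs hσ] at hint ⊢
  rw [integrable_withDensity_iff_integrable_smul' hf (by simp)] at hint
  rw [integral_withDensity_eq_integral_toReal_smul hf (by simp), integral_prod_symm _ hint]
  refine integral_eq_zero_of_ae (Eventually.of_forall fun y => ?_)
  have hq := marginalDensity_pos (ν := ν) hp hp' hs hσ y
  have h := (integral_inner_sub_posteriorMean (ν := ν) hp hp' hs hσ y (b y)).2
  rw [integral_posteriorLaw hp hp' hs hσ] at h
  have h2 : ∫ x, (marginalDensity ν p₀ s σ t y)⁻¹ * (forwardDensity s σ t x y *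
      inner ℝ (b y) (x - posteriorMean ν p₀ s σ t y)) ∂(dataLaw ν p₀) = 0 := by
    rw [← h]
    refine integral_congr_ae (Eventually.of_forall fun x => ?_)
    simp only [smul_eq_mul]
    ring
  rw [integral_const_mul] at h2
  have h3 := (mul_eq_zero.1 h2).resolve_left (inv_ne_zero hq.ne')
  simp only [ENNReal.toReal_ofReal (forwardDensity_pos hs hσ _ _).le, smul_eq_mul, Pi.zero_apply]
  exact h3

/-- The posterior variance of `x_0` given `x_t = y`. -/
noncomputable def posteriorVariance (ν : Measure (E D)) (p₀ : E D → ℝ) (s σ : ℝ → ℝ) (t : ℝ)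
    (y : E D) : ℝ :=
  ∫ x, ‖x - posteriorMean ν p₀ s σ t y‖ ^ 2 ∂(posteriorLaw ν p₀ s σ t y)

theorem measurable_posteriorVariance [SigmaFinite ν] [IsProbabilityMeasure (dataLaw ν p₀)]
    (hp : Measurable p₀) (hp' : ∀ x, 0 ≤ p₀ x) (hs : 0 < s t) (hσ : 0 < σ t) :
    Measurable (posteriorVariance ν p₀ s σ t) := by
  have e : posteriorVariance ν p₀ s σ t = fun y => ∫ x,
      (forwardDensity s σ t x y / marginalDensity ν p₀ s σ t y) •
        ‖x - posteriorMean ν p₀ s σ t y‖ ^ 2 ∂(dataLaw ν p₀) := by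
    funext y
    exact integral_posteriorLaw hp hp' hs hσ y _
  have h : Measurable fun z : E D × E D =>
      (forwardDensity s σ t z.1 z.2 / marginalDensity ν p₀ s σ t z.2) •
        ‖z.1 - posteriorMean ν p₀ s σ t z.2‖ ^ 2 :=
    ((measurable_forwardDensity s σ t).div ((measurable_marginalDensity hp).comp
      measurable_snd)).smul
      ((measurable_fst.sub ((measurable_posteriorMean hp).comp measurable_snd)).norm.pow_const 2)
  rw [e]
  exact h.stronglyMeasurable.integral_prod_left'.measurable

/-- The mean of the posterior variance is the minimum mean squared error. -/
theorem integral_posteriorVariance_jointLaw [SigmaFinite ν] [IsProbabilityMeasure (dataLaw ν p₀)]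
    (hp : Measurable p₀) (hp' : ∀ x, 0 ≤ p₀ x) (hs : 0 < s t) (hσ : 0 < σ t) :
    Integrable (fun z : E D × E D => posteriorVariance ν p₀ s σ t z.2) (jointLaw ν p₀ s σ t) ∧
    ∫ z, posteriorVariance ν p₀ s σ t z.2 ∂(jointLaw ν p₀ s σ t) = sqError ν p₀ s σ t := by
  have hm : Measurable fun z : E D × E D => posteriorVariance ν p₀ s σ t z.2 :=
    (measurable_posteriorVariance hp hp' hs hσ).comp measurable_snd
  have hnn : ∀ y, 0 ≤ posteriorVariance ν p₀ s σ t y := fun y =>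
    integral_nonneg fun _ => sq_nonneg _
  have key : ∫⁻ z, ENNReal.ofReal (posteriorVariance ν p₀ s σ t z.2) ∂(jointLaw ν p₀ s σ t)
      = ENNReal.ofReal (sqError ν p₀ s σ t) := by
    rw [lintegral_jointLaw_eq_lintegral_posteriorLaw hp hp' hs hσ hm.ennreal_ofReal,
      ofReal_sqError hp hp' hs hσ, estimatorError_eq hp hp' hs hσ (measurable_posteriorMean (ν := ν) hp)]
    refine lintegral_congr fun y => ?_
    have := isProbabilityMeasure_posteriorLaw (ν := ν) hp hp' hs hσ y
    simp only
    rw [lintegral_const, measure_univ, mul_one, posteriorVariance,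
      ofReal_integral_eq_lintegral_ofReal (integrable_norm_sub_sq_posteriorLaw hp hp' hs hσ y _)
      (Eventually.of_forall fun _ => sq_nonneg _)]
  refine ⟨⟨hm.aestronglyMeasurable, ?_⟩, ?_⟩
  · rw [hasFiniteIntegral_iff_ofReal (Eventually.of_forall fun q => hnn _), key]
    exact ENNReal.ofReal_lt_top
  · rw [integral_eq_lintegral_of_nonneg_ae (Eventually.of_forall fun q => hnn _)
      hm.aestronglyMeasurable, key, ENNReal.toReal_ofReal (sqError_nonneg ν p₀ s σ t)]

/-- The score of the channel is a posterior expectation; centring it at the posterior mean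
removes the mixed terms. -/
theorem channelScore_div_channelEvidence [IsProbabilityMeasure (dataLaw ν p₀)]
    (hp : Measurable p₀) (hp' : ∀ x, 0 ≤ p₀ x) (hs : 0 < s t) (hσ : 0 < σ t) (x z : E D) {y : E D}
    (hy : y = s t • x + (s t * σ t) • z) :
    channelScore (dataLaw ν p₀) (σ t)⁻¹ x z / channelEvidence (dataLaw ν p₀) (σ t)⁻¹ x z
      = inner ℝ ((σ t)⁻¹ • (x - posteriorMean ν p₀ s σ t y) + z)
          (x - posteriorMean ν p₀ s σ t y)
        + (σ t)⁻¹ * posteriorVariance ν p₀ s σ t y := by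
  have := isProbabilityMeasure_posteriorLaw (ν := ν) hp hp' hs hσ y
  set m := posteriorMean ν p₀ s σ t y with hm
  set a := (σ t)⁻¹ with ha
  have h1 : channelScore (dataLaw ν p₀) a x z / channelEvidence (dataLaw ν p₀) a x z
      = ∫ x', inner ℝ (a • (x - x') + z) (x - x') ∂(posteriorLaw ν p₀ s σ t y) := by
    rw [integral_posteriorLaw hp hp' hs hσ, channelScore, ← integral_div]
    refine integral_congr_ae (Eventually.of_forall fun x' => ?_)
    have hK : 0 < (2 * Real.pi * (s t ^ 2 * σ t ^ 2)) ^ (-(D : ℝ) / 2) := by positivity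
    have hL := channelEvidence_pos (dataLaw ν p₀) a x z
    simp only [smul_eq_mul]
    rw [hy, forwardDensity_eq_channelWeight hs hσ,
      marginalDensity_eq_channelEvidence hp hp' hs hσ, ← ha, mul_div_mul_left _ _ hK.ne']
    ring
  obtain ⟨i1, e1⟩ := integral_inner_sub_posteriorMean (ν := ν) hp hp' hs hσ y
    (-((2 * a) • (x - m) + z))
  have i2 := (integrable_norm_sub_sq_posteriorLaw (ν := ν) hp hp' hs hσ y m).const_mul a
  rw [← hm] at i1 e1
  have e : ∀ x', inner ℝ (a • (x - x') + z) (x - x')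
      = inner ℝ (a • (x - m) + z) (x - m)
        + inner ℝ (-((2 * a) • (x - m) + z)) (x' - m) + a * ‖x' - m‖ ^ 2 := by
    intro x'
    have h2 : x - x' = (x - m) - (x' - m) := by abel
    rw [h2]
    generalize x - m = u
    generalize x' - m = v
    rw [← real_inner_self_eq_norm_sq]
    simp only [inner_sub_left, inner_sub_right, inner_add_left, real_inner_smul_left, smul_sub,
      inner_neg_left, real_inner_comm u v]
    ring
  have i3 : Integrable (fun x' => inner ℝ (a • (x - m) + z) (x - m)
        + inner ℝ (-((2 * a) • (x - m) + z)) (x' - m)) (posteriorLaw ν p₀ s σ t y) :=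
    (integrable_const _).add i1
  rw [h1, integral_congr_ae (Eventually.of_forall e), integral_add i3 i2,
    integral_add (integrable_const _) i1, e1, integral_const, probReal_univ, one_smul, add_zero,
    integral_const_mul, posteriorVariance]

/-- The expected score is the gain times the minimum mean squared error: the first term of
`channelScore_div_channelEvidence` averages to zero by orthogonality. -/
theorem integral_channelScore_div_channelEvidence [SigmaFinite ν]
    [IsProbabilityMeasure (dataLaw ν p₀)]
    (hp : Measurable p₀) (hp' : ∀ x, 0 ≤ p₀ x) (hs : 0 < s t) (hσ : 0 < σ t) :
    ∫ q, channelScore (dataLaw ν p₀) (σ t)⁻¹ q.1 q.2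
        / channelEvidence (dataLaw ν p₀) (σ t)⁻¹ q.1 q.2
        ∂((dataLaw ν p₀).prod (stdGaussian (E D)))
      = (σ t)⁻¹ * sqError ν p₀ s σ t := by
  set m := posteriorMean ν p₀ s σ t with hm
  set g : E D × E D → E D × E D := fun z => (z.1, s t • z.1 + (s t * σ t) • z.2) with hg
  have hgm : Measurable g := by fun_prop
  have hmm : Measurable m := measurable_posteriorMean hp
  have hmap : jointLaw ν p₀ s σ t = Measure.map g _ := jointLaw_eq_map hp hs hσ
  obtain ⟨iV, eV⟩ := integral_posteriorVariance_jointLaw (ν := ν) hp hp' hs hσ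
  set b : E D → E D := fun y => (s t * σ t)⁻¹ • y - (σ t)⁻¹ • m y with hb
  have hbm : Measurable fun z : E D × E D => inner ℝ (b z.2) (z.1 - m z.2) := by fun_prop
  -- the first argument of the inner product depends on the observation only, although it is
  -- written in terms of the signal and the noise
  have ib : ∀ q : E D × E D, b (g q).2 = (σ t)⁻¹ • (q.1 - m (g q).2) + q.2 := by
    intro q
    simp only [hb, hg]
    rw [smul_add, smul_smul, smul_smul, inv_mul_cancel₀ (mul_pos hs hσ).ne', one_smul, smul_sub,
      mul_inv, mul_right_comm, inv_mul_cancel₀ hs.ne', one_mul]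
    abel
  have ib2 : Integrable (fun z : E D × E D => inner ℝ (b z.2) (z.1 - m z.2))
      (jointLaw ν p₀ s σ t) := by
    have h1 := integrable_norm_sub_posteriorMean_sq (ν := ν) hp hp' hs hσ
    rw [hmap] at h1 ⊢
    rw [integrable_map_measure hbm.aestronglyMeasurable hgm.aemeasurable]
    have h2 := h1.comp_measurable hgm
    have hz : Integrable (fun q : E D × E D => ‖q.2‖ ^ 2)
        ((dataLaw ν p₀).prod (stdGaussian (E D))) :=
      integrable_norm_sq_stdGaussian.comp_snd (dataLaw ν p₀)
    refine Integrable.mono' ((h2.const_mul ((σ t)⁻¹ + 1)).add hz)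
      (hbm.comp hgm).aestronglyMeasurable (Eventually.of_forall fun q => ?_)
    simp only [Function.comp_apply, Pi.add_apply]
    rw [ib q, ← hm]
    change ‖inner ℝ ((σ t)⁻¹ • (q.1 - m (g q).2) + q.2) (q.1 - m (g q).2)‖
      ≤ ((σ t)⁻¹ + 1) * ‖q.1 - m (g q).2‖ ^ 2 + ‖q.2‖ ^ 2
    generalize q.1 - m (g q).2 = u
    rw [inner_add_left, real_inner_smul_left, real_inner_self_eq_norm_sq, Real.norm_eq_abs]
    have h3 := abs_real_inner_le_norm q.2 u
    have h4 : 0 ≤ (σ t)⁻¹ * ‖u‖ ^ 2 := by positivity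
    refine (abs_add_le _ _).trans ?_
    rw [abs_of_nonneg h4]
    nlinarith [sq_nonneg (‖q.2‖ - ‖u‖), sq_nonneg ‖q.2‖, sq_nonneg ‖u‖]
  have h0 := integral_inner_sub_posteriorMean_jointLaw hp hp' hs hσ ib2
  have iV2 := iV.const_mul (σ t)⁻¹
  have hVm : Measurable fun z : E D × E D => inner ℝ (b z.2) (z.1 - m z.2)
      + (σ t)⁻¹ * posteriorVariance ν p₀ s σ t z.2 :=
    hbm.add (((measurable_posteriorVariance hp hp' hs hσ).comp measurable_snd).const_mul _)
  have h5 : ∫ z, (inner ℝ (b z.2) (z.1 - m z.2)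
      + (σ t)⁻¹ * posteriorVariance ν p₀ s σ t z.2) ∂(jointLaw ν p₀ s σ t)
      = (σ t)⁻¹ * sqError ν p₀ s σ t := by
    rw [integral_add ib2 iV2, integral_const_mul, eV, h0, zero_add]
  rw [← h5, hmap, integral_map hgm.aemeasurable hVm.aestronglyMeasurable]
  refine integral_congr_ae (Eventually.of_forall fun q => ?_)
  simp only
  rw [channelScore_div_channelEvidence hp hp' hs hσ q.1 q.2 (y := (g q).2) rfl, ib q]

end MMSE


/-! ### Entropy, information and their rates -/

section Rates

variable {D : ℕ} {ν : Measure (E D)} {p₀ : E D → ℝ} {s σ : ℝ → ℝ} {t : ℝ}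

theorem integrable_log_channelEvidence [SigmaFinite ν] [IsProbabilityMeasure (dataLaw ν p₀)]
    (hp : Measurable p₀) (hp' : ∀ x, 0 ≤ p₀ x) (hs : 0 < s t) (hσ : 0 < σ t)
    (hH : Integrable (fun x => Real.log (marginalDensity ν p₀ s σ t x))
      (marginalLaw ν p₀ s σ t)) :
    Integrable (fun q : E D × E D =>
        Real.log (channelEvidence (dataLaw ν p₀) (σ t)⁻¹ q.1 q.2))
      ((dataLaw ν p₀).prod (stdGaussian (E D))) := by
  have hg : Measurable fun z : E D × E D => (z.1, s t • z.1 + (s t * σ t) • z.2) := by fun_prop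
  rw [← map_snd_jointLaw hp hp' hs hσ, jointLaw_eq_map hp hs hσ,
    Measure.map_map measurable_snd hg] at hH
  have h := hH.comp_measurable (measurable_snd.comp hg)
  refine (h.sub (integrable_const
    (Real.log ((2 * Real.pi * (s t ^ 2 * σ t ^ 2)) ^ (-(D : ℝ) / 2))))).congr
    (Eventually.of_forall fun q => ?_)
  have hK : 0 < (2 * Real.pi * (s t ^ 2 * σ t ^ 2)) ^ (-(D : ℝ) / 2) := by positivity
  simp only [Pi.sub_apply, Function.comp_apply]
  rw [marginalDensity_eq_channelEvidence hp hp' hs hσ,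
    Real.log_mul hK.ne' (channelEvidence_pos _ _ _ _).ne', add_sub_cancel_left]

theorem ae_dataLaw_pos (hp : Measurable p₀) : ∀ᵐ x ∂(dataLaw ν p₀), 0 < p₀ x := by
  rw [dataLaw, ae_withDensity_iff hp.ennreal_ofReal]
  refine Eventually.of_forall fun x hx => ?_
  by_contra h
  exact hx (ENNReal.ofReal_of_nonpos (not_lt.1 h))

/-- The pointwise mutual information of `x_0` and `x_t`, in terms of `x_0` and the noise. -/
theorem log_forwardDensity_div_marginalDensity [IsProbabilityMeasure (dataLaw ν p₀)]
    (hp : Measurable p₀) (hp' : ∀ x, 0 ≤ p₀ x) (hs : 0 < s t) (hσ : 0 < σ t) (x z : E D) :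
    Real.log (forwardDensity s σ t x (s t • x + (s t * σ t) • z)
        / marginalDensity ν p₀ s σ t (s t • x + (s t * σ t) • z))
      = -Real.log (channelEvidence (dataLaw ν p₀) (σ t)⁻¹ x z) - ‖z‖ ^ 2 / 2 := by
  have hK : 0 < (2 * Real.pi * (s t ^ 2 * σ t ^ 2)) ^ (-(D : ℝ) / 2) := by positivity
  have hL := channelEvidence_pos (dataLaw ν p₀) (σ t)⁻¹ x z
  rw [forwardDensity_eq_channelWeight hs hσ, marginalDensity_eq_channelEvidence hp hp' hs hσ,
    mul_div_mul_left _ _ hK.ne', Real.log_div (channelWeight_pos _ _ _ _).ne' hL.ne',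
    channelWeight, sub_self, smul_zero, zero_add, Real.log_exp]
  ring

/-- This holds only almost everywhere, because `Real.log 0 = 0` breaks the logarithm of the
product where `p₀` vanishes. -/
theorem log_posteriorDensity_ae [SigmaFinite ν] [IsProbabilityMeasure (dataLaw ν p₀)]
    (hp : Measurable p₀) (hp' : ∀ x, 0 ≤ p₀ x) (hs : 0 < s t) (hσ : 0 < σ t) :
    ∀ᵐ q ∂((dataLaw ν p₀).prod (stdGaussian (E D))),
      Real.log (posteriorDensity ν p₀ s σ t q.1 (s t • q.1 + (s t * σ t) • q.2))
        = Real.log (p₀ q.1) + (-Real.log (channelEvidence (dataLaw ν p₀) (σ t)⁻¹ q.1 q.2)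
          - ‖q.2‖ ^ 2 / 2) := by
  have h : ∀ᵐ q ∂((dataLaw ν p₀).prod (stdGaussian (E D))), 0 < p₀ q.1 :=
    Measure.quasiMeasurePreserving_fst.ae (ae_dataLaw_pos hp)
  filter_upwards [h] with q hq
  rw [← log_forwardDensity_div_marginalDensity hp hp' hs hσ, ← Real.log_mul hq.ne'
    (div_pos (forwardDensity_pos hs hσ _ _) (marginalDensity_pos hp hp' hs hσ _)).ne',
    posteriorDensity]
  congr 1
  ring

theorem integrable_log_forwardDensity_div_marginalDensity [SigmaFinite ν]
    [IsProbabilityMeasure (dataLaw ν p₀)]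
    (hp : Measurable p₀) (hp' : ∀ x, 0 ≤ p₀ x) (hs : 0 < s t) (hσ : 0 < σ t)
    (hH : Integrable (fun x => Real.log (marginalDensity ν p₀ s σ t x))
      (marginalLaw ν p₀ s σ t)) :
    Integrable (fun q : E D × E D =>
        -Real.log (channelEvidence (dataLaw ν p₀) (σ t)⁻¹ q.1 q.2) - ‖q.2‖ ^ 2 / 2)
      ((dataLaw ν p₀).prod (stdGaussian (E D))) :=
  (integrable_log_channelEvidence hp hp' hs hσ hH).neg.sub
    ((integrable_norm_sq_stdGaussian.comp_snd (dataLaw ν p₀)).div_const 2)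

theorem integral_log_forwardDensity_div_marginalDensity [SigmaFinite ν]
    [IsProbabilityMeasure (dataLaw ν p₀)]
    (hp : Measurable p₀) (hp' : ∀ x, 0 ≤ p₀ x) (hs : 0 < s t) (hσ : 0 < σ t)
    (hH : Integrable (fun x => Real.log (marginalDensity ν p₀ s σ t x))
      (marginalLaw ν p₀ s σ t)) :
    ∫ q : E D × E D, (-Real.log (channelEvidence (dataLaw ν p₀) (σ t)⁻¹ q.1 q.2)
          - ‖q.2‖ ^ 2 / 2) ∂((dataLaw ν p₀).prod (stdGaussian (E D)))
      = ∫ q, -Real.log (channelEvidence (dataLaw ν p₀) (σ t)⁻¹ q.1 q.2)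
          ∂((dataLaw ν p₀).prod (stdGaussian (E D)))
        - ∫ q, ‖q.2‖ ^ 2 / 2 ∂((dataLaw ν p₀).prod (stdGaussian (E D))) :=
  integral_sub (integrable_log_channelEvidence hp hp' hs hσ hH).neg
    ((integrable_norm_sq_stdGaussian.comp_snd (dataLaw ν p₀)).div_const 2)

theorem integrable_log_posteriorDensity [SigmaFinite ν] [IsProbabilityMeasure (dataLaw ν p₀)]
    (hp : Measurable p₀) (hp' : ∀ x, 0 ≤ p₀ x) (hs : 0 < s t) (hσ : 0 < σ t)
    (hH₀ : Integrable (fun x => Real.log (p₀ x)) (dataLaw ν p₀))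
    (hH : Integrable (fun x => Real.log (marginalDensity ν p₀ s σ t x))
      (marginalLaw ν p₀ s σ t)) :
    Integrable (fun z : E D × E D => Real.log (posteriorDensity ν p₀ s σ t z.1 z.2))
      (jointLaw ν p₀ s σ t) := by
  rw [jointLaw_eq_map hp hs hσ, integrable_map_measure
    (measurable_posteriorDensity hp).log.aestronglyMeasurable (by fun_prop)]
  have h := (hH₀.comp_fst (stdGaussian (E D))).add
    (integrable_log_forwardDensity_div_marginalDensity hp hp' hs hσ hH)
  refine h.congr ?_
  filter_upwards [log_posteriorDensity_ae (ν := ν) hp hp' hs hσ] with q hq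
  exact hq.symm

/-- The conditional entropy is `H[x_0]` minus the mutual information, the latter being written
as an expected log-likelihood ratio. -/
theorem condEntropy_eq [SigmaFinite ν] [IsProbabilityMeasure (dataLaw ν p₀)]
    (hp : Measurable p₀) (hp' : ∀ x, 0 ≤ p₀ x) (hs : 0 < s t) (hσ : 0 < σ t)
    (hH₀ : Integrable (fun x => Real.log (p₀ x)) (dataLaw ν p₀))
    (hH : Integrable (fun x => Real.log (marginalDensity ν p₀ s σ t x))
      (marginalLaw ν p₀ s σ t)) :
    condEntropy ν p₀ s σ t
      = -∫ q, Real.log (p₀ q.1) ∂((dataLaw ν p₀).prod (stdGaussian (E D)))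
        - (∫ q, -Real.log (channelEvidence (dataLaw ν p₀) (σ t)⁻¹ q.1 q.2)
            ∂((dataLaw ν p₀).prod (stdGaussian (E D)))
          - ∫ q, ‖q.2‖ ^ 2 / 2 ∂((dataLaw ν p₀).prod (stdGaussian (E D)))) := by
  rw [condEntropy, jointLaw_eq_map hp hs hσ, integral_map (by fun_prop)
    (measurable_posteriorDensity hp).log.aestronglyMeasurable,
    integral_congr_ae (log_posteriorDensity_ae hp hp' hs hσ),
    integral_add (hH₀.comp_fst (stdGaussian (E D)))
      (integrable_log_forwardDensity_div_marginalDensity hp hp' hs hσ hH),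
    integral_log_forwardDensity_div_marginalDensity hp hp' hs hσ hH]
  ring

theorem jointLaw_eq_withDensity_prod_marginalLaw [SigmaFinite ν]
    [IsProbabilityMeasure (dataLaw ν p₀)]
    (hp : Measurable p₀) (hp' : ∀ x, 0 ≤ p₀ x) (hs : 0 < s t) (hσ : 0 < σ t) :
    jointLaw ν p₀ s σ t = ((dataLaw ν p₀).prod (marginalLaw ν p₀ s σ t)).withDensity
      fun z => ENNReal.ofReal (forwardDensity s σ t z.1 z.2 / marginalDensity ν p₀ s σ t z.2) := by
  have hq : Measurable (marginalDensity ν p₀ s σ t) := measurable_marginalDensity hp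
  have hq2 : Measurable fun z : E D × E D => marginalDensity ν p₀ s σ t z.2 :=
    hq.comp measurable_snd
  have hr : Measurable fun z : E D × E D =>
      forwardDensity s σ t z.1 z.2 / marginalDensity ν p₀ s σ t z.2 :=
    (measurable_forwardDensity s σ t).div hq2
  rw [marginalLaw, prod_withDensity_right hq.ennreal_ofReal,
    ← withDensity_mul _ hq2.ennreal_ofReal hr.ennreal_ofReal,
    jointLaw_eq_withDensity_dataLaw hp hs hσ]
  congr 1
  funext z
  have hz := marginalDensity_pos (ν := ν) hp hp' hs hσ z.2
  rw [Pi.mul_apply, ← ENNReal.ofReal_mul hz.le, mul_div_cancel₀ _ hz.ne']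

theorem llr_jointLaw_ae [SigmaFinite ν] [IsProbabilityMeasure (dataLaw ν p₀)]
    (hp : Measurable p₀) (hp' : ∀ x, 0 ≤ p₀ x) (hs : 0 < s t) (hσ : 0 < σ t) :
    jointLaw ν p₀ s σ t ≪ (dataLaw ν p₀).prod (marginalLaw ν p₀ s σ t) ∧
    llr (jointLaw ν p₀ s σ t) ((dataLaw ν p₀).prod (marginalLaw ν p₀ s σ t))
      =ᵐ[jointLaw ν p₀ s σ t] fun z =>
        Real.log (forwardDensity s σ t z.1 z.2 / marginalDensity ν p₀ s σ t z.2) := by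
  have := isProbabilityMeasure_jointLaw (ν := ν) hp hs hσ
  have : IsProbabilityMeasure (marginalLaw ν p₀ s σ t) := by
    rw [← map_snd_jointLaw hp hp' hs hσ]
    exact Measure.isProbabilityMeasure_map (by fun_prop)
  have hq : Measurable (marginalDensity ν p₀ s σ t) := measurable_marginalDensity hp
  have he := jointLaw_eq_withDensity_prod_marginalLaw (ν := ν) hp hp' hs hσ
  have hac : jointLaw ν p₀ s σ t ≪ (dataLaw ν p₀).prod (marginalLaw ν p₀ s σ t) := by
    rw [he]
    exact withDensity_absolutelyContinuous _ _
  refine ⟨hac, ?_⟩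
  have h := Measure.rnDeriv_withDensity ((dataLaw ν p₀).prod (marginalLaw ν p₀ s σ t))
    ((measurable_forwardDensity s σ t).div (hq.comp measurable_snd)).ennreal_ofReal
  have h2 := hac.ae_le h
  filter_upwards [h2] with z hz
  have hpos := div_pos (forwardDensity_pos hs hσ z.1 z.2)
    (marginalDensity_pos (ν := ν) hp hp' hs hσ z.2)
  rw [llr, he]
  refine congrArg Real.log ((congrArg ENNReal.toReal hz).trans ?_)
  exact ENNReal.toReal_ofReal hpos.le

theorem mutualInfo_eq [SigmaFinite ν] [IsProbabilityMeasure (dataLaw ν p₀)]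
    (hp : Measurable p₀) (hp' : ∀ x, 0 ≤ p₀ x) (hs : 0 < s t) (hσ : 0 < σ t)
    (hH : Integrable (fun x => Real.log (marginalDensity ν p₀ s σ t x))
      (marginalLaw ν p₀ s σ t)) :
    mutualInfo ν p₀ s σ t ≠ ⊤ ∧ (mutualInfo ν p₀ s σ t).toReal
      = ∫ q, -Real.log (channelEvidence (dataLaw ν p₀) (σ t)⁻¹ q.1 q.2)
            ∂((dataLaw ν p₀).prod (stdGaussian (E D)))
          - ∫ q, ‖q.2‖ ^ 2 / 2 ∂((dataLaw ν p₀).prod (stdGaussian (E D))) := by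
  have := isProbabilityMeasure_jointLaw (ν := ν) hp hs hσ
  have : IsProbabilityMeasure (marginalLaw ν p₀ s σ t) := by
    rw [← map_snd_jointLaw hp hp' hs hσ]
    exact Measure.isProbabilityMeasure_map (by fun_prop)
  obtain ⟨hac, hllr⟩ := llr_jointLaw_ae (ν := ν) hp hp' hs hσ
  have hm : Measurable fun z : E D × E D =>
      Real.log (forwardDensity s σ t z.1 z.2 / marginalDensity ν p₀ s σ t z.2) :=
    ((measurable_forwardDensity s σ t).div
      ((measurable_marginalDensity hp).comp measurable_snd)).log
  have hmap := jointLaw_eq_map (ν := ν) (t := t) hp hs hσ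
  have hint : Integrable (llr (jointLaw ν p₀ s σ t)
      ((dataLaw ν p₀).prod (marginalLaw ν p₀ s σ t))) (jointLaw ν p₀ s σ t) := by
    rw [integrable_congr hllr, hmap, integrable_map_measure hm.aestronglyMeasurable (by fun_prop)]
    refine (integrable_log_forwardDensity_div_marginalDensity hp hp' hs hσ hH).congr
      (Eventually.of_forall fun q => ?_)
    exact (log_forwardDensity_div_marginalDensity hp hp' hs hσ q.1 q.2).symm
  refine ⟨InformationTheory.klDiv_ne_top hac hint, ?_⟩
  rw [mutualInfo, InformationTheory.toReal_klDiv_of_measure_eq hac (by simp),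
    integral_congr_ae hllr, hmap, integral_map (by fun_prop) hm.aestronglyMeasurable,
    ← integral_log_forwardDensity_div_marginalDensity hp hp' hs hσ hH]
  refine integral_congr_ae (Eventually.of_forall fun q => ?_)
  exact log_forwardDensity_div_marginalDensity hp hp' hs hσ q.1 q.2

/-- The derivative of the information in the channel gain `a = 1 / σ` is `a` times the minimum
mean squared error. -/
theorem hasDerivAt_integral_neg_log_channelEvidence_comp [SigmaFinite ν]
    [IsProbabilityMeasure (dataLaw ν p₀)]
    (hp : Measurable p₀) (hp' : ∀ x, 0 ≤ p₀ x) (hs : 0 < s t) (hσ : 0 < σ t)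
    (hσ' : DifferentiableAt ℝ σ t)
    (hH : Integrable (fun x => Real.log (marginalDensity ν p₀ s σ t x))
      (marginalLaw ν p₀ s σ t)) :
    HasDerivAt (fun τ => ∫ q, -Real.log (channelEvidence (dataLaw ν p₀) (σ τ)⁻¹ q.1 q.2)
        ∂((dataLaw ν p₀).prod (stdGaussian (E D))))
      (-(deriv σ t / σ t ^ 3 * sqError ν p₀ s σ t)) t := by
  have ha : 0 < (σ t)⁻¹ := by positivity
  have h := (hasDerivAt_integral_neg_log_channelEvidence (dataLaw ν p₀) ha
    (integrable_log_channelEvidence hp hp' hs hσ hH)).2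
  rw [integral_channelScore_div_channelEvidence hp hp' hs hσ] at h
  have h2 := h.comp t (hσ'.hasDerivAt.fun_inv hσ.ne')
  refine h2.congr_deriv ?_
  field_simp

theorem hasDerivAt_condEntropy [SigmaFinite ν] [IsProbabilityMeasure (dataLaw ν p₀)]
    (hp : Measurable p₀) (hp' : ∀ x, 0 ≤ p₀ x) {J : Set ℝ} (hJ : IsOpen J)
    (hs : ∀ t ∈ J, 0 < s t) (hσ : ∀ t ∈ J, 0 < σ t) (ht : t ∈ J) (hσ' : DifferentiableAt ℝ σ t)
    (hH₀ : Integrable (fun x => Real.log (p₀ x)) (dataLaw ν p₀))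
    (hH : ∀ t ∈ J, Integrable (fun x => Real.log (marginalDensity ν p₀ s σ t x))
      (marginalLaw ν p₀ s σ t)) :
    HasDerivAt (condEntropy ν p₀ s σ) (deriv σ t / σ t ^ 3 * sqError ν p₀ s σ t) t := by
  have h := hasDerivAt_integral_neg_log_channelEvidence_comp hp hp' (hs t ht) (hσ t ht) hσ'
    (hH t ht)
  refine (((h.sub_const
    (∫ q, ‖q.2‖ ^ 2 / 2 ∂((dataLaw ν p₀).prod (stdGaussian (E D))))).const_sub
    (-∫ q, Real.log (p₀ q.1) ∂((dataLaw ν p₀).prod (stdGaussian (E D))))).congr_deriv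
    (neg_neg _)).congr_of_eventuallyEq ?_
  filter_upwards [hJ.mem_nhds ht] with τ hτ
  exact condEntropy_eq hp hp' (hs τ hτ) (hσ τ hτ) hH₀ (hH τ hτ)

theorem hasDerivAt_mutualInfo [SigmaFinite ν] [IsProbabilityMeasure (dataLaw ν p₀)]
    (hp : Measurable p₀) (hp' : ∀ x, 0 ≤ p₀ x) {J : Set ℝ} (hJ : IsOpen J)
    (hs : ∀ t ∈ J, 0 < s t) (hσ : ∀ t ∈ J, 0 < σ t) (ht : t ∈ J) (hσ' : DifferentiableAt ℝ σ t)
    (hH : ∀ t ∈ J, Integrable (fun x => Real.log (marginalDensity ν p₀ s σ t x))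
      (marginalLaw ν p₀ s σ t)) :
    HasDerivAt (fun τ => (mutualInfo ν p₀ s σ τ).toReal)
      (1 / 2 * deriv (fun τ => 1 / σ τ ^ 2) t * sqError ν p₀ s σ t) t := by
  have h := hasDerivAt_integral_neg_log_channelEvidence_comp hp hp' (hs t ht) (hσ t ht) hσ'
    (hH t ht)
  have hσt := hσ t ht
  have hd : HasDerivAt (fun τ => 1 / σ τ ^ 2) (-2 * deriv σ t / σ t ^ 3) t := by
    have h1 := (hσ'.hasDerivAt.fun_pow 2).fun_inv (pow_pos hσt 2).ne'
    simp only [one_div]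
    refine h1.congr_deriv ?_
    field_simp
    push_cast
    ring
  rw [hd.deriv]
  refine ((h.sub_const
    (∫ q, ‖q.2‖ ^ 2 / 2 ∂((dataLaw ν p₀).prod (stdGaussian (E D))))).congr_deriv ?_).congr_of_eventuallyEq ?_
  · ring
  · filter_upwards [hJ.mem_nhds ht] with τ hτ
    exact (mutualInfo_eq hp hp' (hs τ hτ) (hσ τ hτ) (hH τ hτ)).2

theorem estimatorError_congr [SigmaFinite ν] [IsProbabilityMeasure (dataLaw ν p₀)]
    (hp : Measurable p₀) (hp' : ∀ x, 0 ≤ p₀ x) (hs : 0 < s t) (hσ : 0 < σ t) {f g : E D → E D}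
    (h : ∀ᵐ x ∂(marginalLaw ν p₀ s σ t), f x = g x) :
    estimatorError ν p₀ s σ t f = estimatorError ν p₀ s σ t g := by
  rw [← map_snd_jointLaw hp hp' hs hσ] at h
  refine lintegral_congr_ae ?_
  filter_upwards [ae_of_ae_map measurable_snd.aemeasurable h] with z hz
  rw [hz]

/-- The training loss of a network is the weighted mean squared error of its prediction. -/
theorem trainingLoss_eq [SigmaFinite ν] [IsProbabilityMeasure (dataLaw ν p₀)]
    (hp : Measurable p₀) (hs : 0 < s t) (hσ : 0 < σ t) {lam : ℝ → ℝ} (cout cskip : ℝ → ℝ)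
    (hlam : 0 < lam t) {F : E D → E D} (hF : Measurable F) :
    trainingLoss ν p₀ s σ lam cout cskip F t = ENNReal.ofReal (lam t * s t ^ 2)
      * estimatorError ν p₀ s σ t (prediction s cout cskip F t) := by
  have hpred : Measurable (prediction s cout cskip F t) := by
    unfold prediction
    fun_prop
  have h : Measurable fun z : E D × E D =>
      ENNReal.ofReal (‖z.1 - prediction s cout cskip F t z.2‖ ^ 2) := by fun_prop
  have h2 : Measurable fun q : E D × E D => ENNReal.ofReal (‖q.1
      - prediction s cout cskip F t (s t • q.1 + (s t * σ t) • q.2)‖ ^ 2) := by fun_prop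
  rw [estimatorError, jointLaw_eq_map hp hs hσ, lintegral_map h (by fun_prop),
    ← lintegral_const_mul _ h2, trainingLoss]
  refine lintegral_congr fun q => ?_
  rw [← ENNReal.ofReal_mul (by positivity), mul_assoc]
  congr 2
  generalize s t • q.1 + (s t * σ t) • q.2 = y
  have e : cout t • F y - s t • q.1 + cskip t • y
      = (-s t) • (q.1 - prediction s cout cskip F t y) := by
    rw [prediction, smul_sub, smul_smul, neg_mul, mul_inv_cancel₀ hs.ne']
    simp only [neg_smul, one_smul]
    abel
  rw [e, norm_smul, mul_pow, norm_neg, Real.norm_eq_abs, sq_abs]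

end Rates

end EDM

theorem mainTheorem3 {D : ℕ}
    -- the data distribution: a probability density `p₀` with respect to `ν`
    (ν : Measure (EDM.E D)) [SigmaFinite ν]
    (p₀ : EDM.E D → ℝ) (hp₀_meas : Measurable p₀) (hp₀_nonneg : ∀ x, 0 ≤ p₀ x)
    [IsProbabilityMeasure (EDM.dataLaw ν p₀)]
    -- the scaling and the noise schedule on a set `J` of times
    (J : Set ℝ) (hJ : IsOpen J) (s σ : ℝ → ℝ)
    (hs_pos : ∀ t ∈ J, 0 < s t) (hσ_pos : ∀ t ∈ J, 0 < σ t)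
    (hs_diff : ∀ t ∈ J, DifferentiableAt ℝ s t) (hσ_diff : ∀ t ∈ J, DifferentiableAt ℝ σ t)
    (hσ_mono : ∀ t ∈ J, 0 ≤ deriv σ t)
    -- the entropies `H[x_0]` and `H[x_t]` are finite
    (hH₀ : Integrable (fun x => Real.log (p₀ x)) (EDM.dataLaw ν p₀))
    (hH : ∀ t ∈ J, Integrable (fun x => Real.log (EDM.marginalDensity ν p₀ s σ t x))
      (EDM.marginalLaw ν p₀ s σ t)) :
    -- the Gaussian kernel is the transition density of the EDM forward SDE
    ((∀ x₀ : EDM.E D,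
        (∀ t ∈ J, ∀ x : EDM.E D,
          EDM.SolvesFokkerPlanckAt (EDM.drift s) (EDM.diffusion s σ)
            (fun τ y => EDM.forwardDensity s σ τ x₀ y) t x) ∧
        (∀ t₀ : ℝ, Tendsto s (𝓝[J] t₀) (𝓝 1) → Tendsto σ (𝓝[J] t₀) (𝓝 0) →
          ∀ φ : BoundedContinuousFunction (EDM.E D) ℝ,
            Tendsto (fun τ => ∫ x, φ x * EDM.forwardDensity s σ τ x₀ x) (𝓝[J] t₀)
              (𝓝 (φ x₀))))) ∧
    ∀ t ∈ J,
      -- the quantities below are given by convergent integrals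
      Integrable (fun z : EDM.E D × EDM.E D =>
        Real.log (EDM.posteriorDensity ν p₀ s σ t z.1 z.2)) (EDM.jointLaw ν p₀ s σ t) ∧
      EDM.mutualInfo ν p₀ s σ t ≠ ⊤ ∧
      (∀ x, Integrable (fun y₀ => EDM.posteriorDensity ν p₀ s σ t y₀ x • y₀) ν) ∧
      Integrable (fun z : EDM.E D × EDM.E D =>
        ‖z.1 - EDM.posteriorMean ν p₀ s σ t z.2‖ ^ 2) (EDM.jointLaw ν p₀ s σ t) ∧
      -- `ε_t²` is the minimum mean squared error of recovering `x_0` from `x_t`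
      IsLeast {r : ℝ≥0∞ | ∃ xhat : EDM.E D → EDM.E D, Measurable xhat ∧
          r = EDM.estimatorError ν p₀ s σ t xhat}
        (ENNReal.ofReal (EDM.sqError ν p₀ s σ t)) ∧
      -- the entropy rate
      HasDerivAt (EDM.condEntropy ν p₀ s σ)
        (deriv σ t / σ t ^ 3 * EDM.sqError ν p₀ s σ t) t ∧
      -- the I-MMSE identity, with signal-to-noise ratio `1 / σ²`
      HasDerivAt (fun τ => (EDM.mutualInfo ν p₀ s σ τ).toReal)
        (1 / 2 * deriv (fun τ => 1 / σ τ ^ 2) t * EDM.sqError ν p₀ s σ t) t ∧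
      -- the entropy rate from the training loss of an ideal network
      ∀ lam cout cskip : ℝ → ℝ, 0 < lam t →
        ∀ F : EDM.E D → EDM.E D, Measurable F →
          (∀ᵐ x ∂(EDM.marginalLaw ν p₀ s σ t),
            EDM.prediction s cout cskip F t x = EDM.posteriorMean ν p₀ s σ t x) →
          EDM.trainingLoss ν p₀ s σ lam cout cskip F t
              = ENNReal.ofReal (lam t * s t ^ 2 * EDM.sqError ν p₀ s σ t) ∧
          (∀ G : EDM.E D → EDM.E D, Measurable G →
            EDM.trainingLoss ν p₀ s σ lam cout cskip F t
              ≤ EDM.trainingLoss ν p₀ s σ lam cout cskip G t) ∧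
          HasDerivAt (EDM.condEntropy ν p₀ s σ)
            (deriv σ t / (lam t * s t ^ 2 * σ t ^ 3)
              * (EDM.trainingLoss ν p₀ s σ lam cout cskip F t).toReal) t := by
  refine ⟨fun x₀ => ⟨fun t ht x => ?_, fun t₀ hs₀ hσ₀ φ => ?_⟩, fun t ht => ?_⟩
  · exact EDM.solvesFokkerPlanckAt_forwardDensity (hs_pos t ht) (hσ_pos t ht) (hs_diff t ht)
      (hσ_diff t ht) (hσ_mono t ht) x₀ x
  · exact EDM.tendsto_integral_forwardDensity hs_pos hσ_pos x₀ hs₀ hσ₀ φ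
  have hs := hs_pos t ht
  have hσ := hσ_pos t ht
  have hent := EDM.hasDerivAt_condEntropy hp₀_meas hp₀_nonneg hJ hs_pos hσ_pos ht
    (hσ_diff t ht) hH₀ hH
  refine ⟨EDM.integrable_log_posteriorDensity hp₀_meas hp₀_nonneg hs hσ hH₀ (hH t ht),
    (EDM.mutualInfo_eq hp₀_meas hp₀_nonneg hs hσ (hH t ht)).1,
    EDM.integrable_posteriorDensity_smul hp₀_meas hp₀_nonneg hs hσ,
    EDM.integrable_norm_sub_posteriorMean_sq hp₀_meas hp₀_nonneg hs hσ,
    EDM.isLeast_estimatorError hp₀_meas hp₀_nonneg hs hσ, hent,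
    EDM.hasDerivAt_mutualInfo hp₀_meas hp₀_nonneg hJ hs_pos hσ_pos ht (hσ_diff t ht) hH,
    fun lam cout cskip hlam F hF hopt => ?_⟩
  have hloss : EDM.trainingLoss ν p₀ s σ lam cout cskip F t
      = ENNReal.ofReal (lam t * s t ^ 2 * EDM.sqError ν p₀ s σ t) := by
    rw [EDM.trainingLoss_eq hp₀_meas hs hσ cout cskip hlam hF,
      EDM.estimatorError_congr hp₀_meas hp₀_nonneg hs hσ hopt,
      ← EDM.ofReal_sqError hp₀_meas hp₀_nonneg hs hσ, ← ENNReal.ofReal_mul (by positivity)]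
  refine ⟨hloss, fun G hG => ?_, ?_⟩
  · rw [EDM.trainingLoss_eq hp₀_meas hs hσ cout cskip hlam hF,
      EDM.trainingLoss_eq hp₀_meas hs hσ cout cskip hlam hG,
      EDM.estimatorError_congr hp₀_meas hp₀_nonneg hs hσ hopt]
    have hpred : Measurable (EDM.prediction s cout cskip G t) := by
      unfold EDM.prediction
      fun_prop
    gcongr
    exact EDM.estimatorError_posteriorMean_le hp₀_meas hp₀_nonneg hs hσ hpred
  · refine hent.congr_deriv ?_
    have h0 := EDM.sqError_nonneg ν p₀ s σ t
    rw [hloss, ENNReal.toReal_ofReal (by positivity)]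
    field_simp
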